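/- Let $D\ge 1$, let $\Lambda$ be a set, and let $\mathbf F=\{F^\lambda\mid\lambda\in\Lambda\}$ be a family of iterated function systems $F^\lambda=\{f_1^\lambda,\dots,f_{M_\lambda}^\lambda\}$ on $\mathbb R^D$ with $1\le M_\lambda$, $M=\sup_\lambda M_\lambda<\infty$ and $f_i^\lambda(x)=T_i^\lambda(x)+a_i^\lambda$, where $a_i^\lambda\in\mathbb R^D$ and $T_i^\lambda$ is linear and non-singular. Write $\sigma_1(T)\ge\dots\ge\sigma_D(T)$ for the singular values of a linear map $T$ of $\mathbb R^D$. Assume that there are $0<\underline\sigma\le\overline\sigma<1$ with $\underline\sigma\le\sigma_D(T_i^\lambda)\le\sigma_1(T_i^\lambda)\le\overline\sigma$ for all $\lambda\in\Lambda$ and $1\le i\le M_\lambda$. For $\alpha\ge0$ set $$\Phi^\alpha(T)=\begin{cases}\sigma_1\cdots\sigma_{m-1}\,\sigma_m^{\alpha-m+1},& m-1\le\alpha<m,\ m\in\{1,\dots,D\},\\ \sigma_1\cdots\sigma_{D-1}\,\sigma_D^{\alpha-D+1},&\alpha\ge D.\end{cases}$$ A code tree $\omega$ is a function $\omega\colon\Sigma_*^\omega\to\Lambda$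 on a set $\Sigma_*^\omega$ of finite words over $\{1,\dots,M\}$ which contains the empty word $\emptyset$ and for which $i_1\cdots i_kl\in\Sigma_*^\omega$ if and only if $i_1\cdots i_k\in\Sigma_*^\omega$ and $l\le M_{\omega(i_1\cdots i_k)}$. For a word $\mathbf i_k=i_1\cdots i_k\in\Sigma_*^\omega$ put $T_{\mathbf i_k}^\omega=T_{i_1}^{\omega(\emptyset)}T_{i_2}^{\omega(i_1)}\cdots T_{i_k}^{\omega(i_1\cdots i_{k-1})}$. Let $\widetilde\Omega$ be the set of pairs $\tilde\omega=(\omega,N)$ of a code tree $\omega$ and a sequence of integers $1\le N_1<N_2<\cdots$ such that, for every $m$, all the sub code trees of $\omega$ rooted at nodes of level $N_m$ are identical: if $\mathbf i,\mathbf i'\in\Sigma_*^\omega$ have length $N_m$ and $\mathbf i\mathbf j\in\Sigma_*^\omega$, then $\mathbf i'\mathbf j\in\Sigma_*^\omega$ and $\omega(\mathbf i\mathbf j)=\omega(\mathbf i'\mathbf j)$. Equip $\widetilde\Omega$ with the Borel $\sigma$-algebra of the topology generated by the cylinders $$[(\omega,N)_m]=\{(\hat\omega,\hat N)\in\widetilde\Omega\mid\hat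 N_i=N_i\text{ for all }i\le m\text{ and }\hat\omega(\tau)=\omega(\tau)\text{ for all }\tau\text{ with }|\tau|<N_m\},\qquad m\ge 1.$$ Define $\Xi\colon\widetilde\Omega\to\widetilde\Omega$ by $\Xi(\omega,N)=(\hat\omega,\hat N)$, where $\hat\omega(\mathbf j)=\omega(\mathbf i\mathbf j)$ for any $\mathbf i\in\Sigma_*^\omega$ of length $N_1$, and $\hat N_m=N_{m+1}-N_1$. **Theorem.** Let $P$ be an ergodic $\Xi$-invariant probability measure on $\widetilde\Omega$ with $\int_{\widetilde\Omega}N_1\,dP<\infty$. Then there is a function $p\colon[0,\infty)\to\mathbb R$, not depending on $\tilde\omega$, such that for $P$-almost every $\tilde\omega=(\omega,N)\in\widetilde\Omega$ the pressure exists for all $\alpha\ge0$ and equals $p(\alpha)$: $$\lim_{k\to\infty}\frac1k\log\sum_{\mathbf i_k\in\Sigma_*^\omega}\Phi^\alpha(T_{\mathbf i_k}^\omega)=p(\alpha)\qquad\text{for all }\alpha\ge 0,$$ where the sum is over the words of length $k$ in $\Sigma_*^\omega$. Moreover, $p$ is continuous and strictly decreasing on $[0,\infty)$, and there is a unique $\alpha_0\ge0$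 with $p(\alpha_0)=0$. -/

import Mathlib

noncomputable section

/-- A family `{F^l : l ∈ Λ}` of iterated function systems on `ℝ^D`. The system `F^l` consists of the
maps `x ↦ lin l i x + trans l i`, where `i` runs through the nonempty index set `Fin (numMaps l)`;
the linear parts are non-singular and the numbers of maps are bounded. -/
structure AffineIFSFamily (Λ : Type*) (D : ℕ) where
  numMaps : Λ → ℕ
  numMaps_pos : ∀ l, 0 < numMaps l
  numMaps_bdd : BddAbove (Set.range numMaps)
  lin : (l : Λ) → Fin (numMaps l) → (EuclideanSpace ℝ (Fin D) →ₗ[ℝ] EuclideanSpace ℝ (Fin D))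
  lin_nonsing : ∀ l i, LinearMap.det (lin l i) ≠ 0
  trans : (l : Λ) → Fin (numMaps l) → EuclideanSpace ℝ (Fin D)

/-- A code tree with values in `F`. Words are lists of letters, with the letters counted from `0`.
The code tree is a function on its own set of nodes; it is encoded as the partial function `label`
on words, so that the nodes are the words where `label` is defined. The empty word is a node, and
`i₁ ⋯ i_k l` is a node if and only if `i₁ ⋯ i_k` is a node with some label `a` and `l` is one of the
`numMaps a` letters of the system with that label. -/
@[ext]
structure CodeTree {Λ : Type*} {D : ℕ} (F : AffineIFSFamily Λ D) where
  label : List ℕ → Option Λ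
  root : (label []).isSome
  child : ∀ (w : List ℕ) (l : ℕ), (label (w ++ [l])).isSome ↔ ∃ a ∈ label w, l < F.numMaps a

namespace CodeTree

variable {Λ : Type*} {D : ℕ} {F : AffineIFSFamily Λ D}

/-- The set of nodes (finite words) of a code tree. -/
def nodes (ω : CodeTree F) : Set (List ℕ) := {w | (ω.label w).isSome}

/-- The nodes of length `k`. -/
def level (ω : CodeTree F) (k : ℕ) : Set (List ℕ) := {w | w ∈ ω.nodes ∧ w.length = k}

theorem level_finite (ω : CodeTree F) (k : ℕ) : (ω.level k).Finite := by
  induction k with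
  | zero =>
    refine (Set.finite_singleton ([] : List ℕ)).subset ?_
    rintro w ⟨-, hw⟩
    simpa using hw
  | succ k ih =>
    obtain ⟨M, hM⟩ := F.numMaps_bdd
    refine ((ih.prod (Set.finite_Iio M)).image fun q => q.1 ++ [q.2]).subset ?_
    rintro w ⟨hw, hlen⟩
    rcases List.eq_nil_or_concat w with rfl | ⟨v, l, rfl⟩
    · simp at hlen
    · rw [List.concat_eq_append] at hw hlen ⊢
      obtain ⟨a, ha, hl⟩ := (ω.child v l).1 hw
      refine ⟨(v, l), ⟨⟨?_, by simpa using hlen⟩, ?_⟩, rfl⟩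
      · simp [nodes, Option.mem_def.1 ha]
      · exact lt_of_lt_of_le hl (hM ⟨a, rfl⟩)

/-- The leftmost word of each length is a node. -/
theorem replicate_mem_nodes (ω : CodeTree F) (k : ℕ) : List.replicate k 0 ∈ ω.nodes := by
  induction k with
  | zero => exact ω.root
  | succ k ih =>
    obtain ⟨a, ha⟩ := Option.isSome_iff_exists.1 ih
    rw [List.replicate_succ']
    exact (ω.child _ _).2 ⟨a, ha, F.numMaps_pos a⟩

/-- The linear part `T_i^{ω(w)}` used at the node `w` for the letter `i`. The value `1` occurs only
when `w i` is not a node. -/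
def stepLin (ω : CodeTree F) (w : List ℕ) (i : ℕ) :
    Module.End ℝ (EuclideanSpace ℝ (Fin D)) :=
  match ω.label w with
  | some a => if h : i < F.numMaps a then F.lin a ⟨i, h⟩ else 1
  | none => 1

/-- `T_{i₁}^{ω(w)} T_{i₂}^{ω(w i₁)} ⋯ T_{i_k}^{ω(w i₁ ⋯ i_{k-1})}` for the word `i₁ ⋯ i_k` read
after the word `w`. -/
def linFrom (ω : CodeTree F) : List ℕ → List ℕ → Module.End ℝ (EuclideanSpace ℝ (Fin D))
  | _, [] => 1
  | w, i :: v => ω.stepLin w i * linFrom ω (w ++ [i]) v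

/-- The product `T_{i₁}^{ω(∅)} T_{i₂}^{ω(i₁)} ⋯ T_{i_k}^{ω(i₁ ⋯ i_{k-1})}` along a word. -/
def wordLin (ω : CodeTree F) (v : List ℕ) : Module.End ℝ (EuclideanSpace ℝ (Fin D)) :=
  ω.linFrom [] v

end CodeTree

/-- The singular value function `Φ^α`. Mathlib counts the singular values
`σ₁ ≥ σ₂ ≥ ⋯ ≥ σ_D` from `0`, so `σ_{i+1}` is `T.singularValues i`. With `m - 1 ≤ α < m`, it is
`σ₁ ⋯ σ_{m-1} σ_m^{α-m+1}` for `α < D`, and it is `σ₁ ⋯ σ_{D-1} σ_D^{α-D+1}` for `α ≥ D`. -/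
def singularValueFun {D : ℕ} (α : ℝ) (T : Module.End ℝ (EuclideanSpace ℝ (Fin D))) : ℝ :=
  if α < D then
    (∏ i ∈ Finset.range ⌊α⌋₊, T.singularValues i) * T.singularValues ⌊α⌋₊ ^ (α - (⌊α⌋₊ : ℝ))
  else
    (∏ i ∈ Finset.range (D - 1), T.singularValues i) *
      T.singularValues (D - 1) ^ (α - (D : ℝ) + 1)

/-- `S^ω(k, α)`, the sum of `Φ^α(T_w^ω)` over the nodes `w` of length `k`. -/
def CodeTree.levelSum {Λ : Type*} {D : ℕ} {F : AffineIFSFamily Λ D} (ω : CodeTree F)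
    (k : ℕ) (α : ℝ) : ℝ :=
  ∑ w ∈ (ω.level_finite k).toFinset, singularValueFun α (ω.wordLin w)

/-- The (natural) pressure of `ω` at `α` exists and equals `p`. -/
def CodeTree.HasPressure {Λ : Type*} {D : ℕ} {F : AffineIFSFamily Λ D} (ω : CodeTree F)
    (α p : ℝ) : Prop :=
  Filter.Tendsto (fun k : ℕ => Real.log (ω.levelSum k α) / k) Filter.atTop (nhds p)

/-- A code tree with a list `N₁ < N₂ < ⋯` of positive neck levels: all the sub code trees rooted at
a neck level are identical. Here `neck m` is `N_m` for `m ≥ 1`, and `neck 0` is `N₀ = 0`. -/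
@[ext]
structure NeckedCodeTree {Λ : Type*} {D : ℕ} (F : AffineIFSFamily Λ D) extends CodeTree F where
  neck : ℕ → ℕ
  neck_zero : neck 0 = 0
  neck_strictMono : StrictMono neck
  identical : ∀ m, ∀ u ∈ toCodeTree.level (neck m), ∀ v ∈ toCodeTree.level (neck m),
    ∀ w, label (u ++ w) = label (v ++ w)

namespace NeckedCodeTree

variable {Λ : Type*} {D : ℕ} {F : AffineIFSFamily Λ D}

/-- The shift `Ξ`, which passes to the sub code tree rooted at level `N₁`, with the neck levels
`N_{m+1} - N₁`. The sub code tree is read at the leftmost node of level `N₁`; by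
`shift_label_eq`, every other node of that level gives the same one. -/
def shift (x : NeckedCodeTree F) : NeckedCodeTree F where
  label w := x.label (List.replicate (x.neck 1) 0 ++ w)
  root := by
    rw [List.append_nil]
    exact x.replicate_mem_nodes (x.neck 1)
  child w l := by
    rw [← List.append_assoc]
    exact x.child (List.replicate (x.neck 1) 0 ++ w) l
  neck m := x.neck (m + 1) - x.neck 1
  neck_zero := by simp
  neck_strictMono := by
    intro a b hab
    have h1 : x.neck 1 ≤ x.neck (a + 1) := x.neck_strictMono.monotone (by omega)
    have h2 : x.neck (a + 1) < x.neck (b + 1) := x.neck_strictMono (by omega)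
    show x.neck (a + 1) - x.neck 1 < x.neck (b + 1) - x.neck 1
    omega
  identical := by
    rintro m u ⟨hu, hul⟩ v ⟨hv, hvl⟩ w
    have h1 : x.neck 1 ≤ x.neck (m + 1) := x.neck_strictMono.monotone (by omega)
    have key := x.identical (m + 1) (List.replicate (x.neck 1) 0 ++ u) ⟨hu, by simp; omega⟩
      (List.replicate (x.neck 1) 0 ++ v) ⟨hv, by simp; omega⟩ w
    simpa only [List.append_assoc] using key

theorem shift_label_eq (x : NeckedCodeTree F) {u : List ℕ} (hu : u ∈ x.level (x.neck 1))
    (w : List ℕ) : x.shift.label w = x.label (u ++ w) :=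
  x.identical 1 _ ⟨x.replicate_mem_nodes _, by simp⟩ u hu w

/-- The cylinder `[x_m]`: the same neck levels up to `N_m`, and the same labels on the words of
length less than `N_m`. -/
def cylinder (x : NeckedCodeTree F) (m : ℕ) : Set (NeckedCodeTree F) :=
  {y | (∀ i ≤ m, y.neck i = x.neck i) ∧
    ∀ w : List ℕ, w.length < x.neck m → y.label w = x.label w}

/-- The topology generated by the cylinders. -/
instance : TopologicalSpace (NeckedCodeTree F) :=
  TopologicalSpace.generateFrom {s | ∃ (x : NeckedCodeTree F) (m : ℕ), 1 ≤ m ∧ s = x.cylinder m}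

/-- The Borel σ-algebra. -/
instance : MeasurableSpace (NeckedCodeTree F) := borel _

instance : BorelSpace (NeckedCodeTree F) := ⟨rfl⟩

end NeckedCodeTree

end

/-!
The sums over the neck levels factor: a word of length `N_{m+n}` is a word of length `N_m` followed
by a word of length `N_n` of the shifted tree `Ξ^m x`, because all the sub code trees rooted at
level `N_m` agree (`NeckedCodeTree.levelSum_neck_add_eq`). The singular value function `Φ^α` is
submultiplicative for `α < D` (`singularValueFun_mul_le`, from Horn's inequality
`LinearMap.prod_singularValues_comp_le`), but with the present convention it is supermultiplicative
for `α ≥ D` (`le_singularValueFun_mul`), being then `|det|` times a power of the smallest singular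
value. Hence `g_n = log S(N_n, α)` is a subadditive or a superadditive cocycle over `Ξ`, and
`|g_n| ≤ C N_n`, where `N_n` is the Birkhoff sum of the integrable function `N_1`. Kingman's theorem
(`Ergodic.exists_ae_tendsto_div_of_subadditive`) gives the almost sure convergence of `g_n / n`,
and Birkhoff's theorem that of `N_n / n` to `∫ N_1 > 0`. As `log S(k, α)` changes by at most a
constant when `k` increases by one, the limit along the neck levels is a limit along all levels
(`tendsto_div_of_tendsto_subsequence`).

All singular values of `T_w`, for `w` of length `k`, lie between `σlo ^ k` and `σhi ^ k`, so
`p α + (β - α) log σlo ≤ p β ≤ p α + (β - α) log σhi` for `α ≤ β`, and the same holds before passing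
to the limit in `k`. The latter makes it enough to treat the countably many rational `α`. The former
shows that `p` is Lipschitz, strictly decreasing and unbounded below; since `p 0 ≥ 0`, it has
exactly one zero.

Both ergodic theorems are proved for ergodic transformations only. Birkhoff's theorem follows from
the boundedness of the Birkhoff sums of a function with negative integral
(`Ergodic.ae_bddAbove_maxBirkhoffSum`); Kingman's theorem follows from Birkhoff's by covering almost
all of a long orbit segment with short segments on which the cocycle has almost its smallest slope
(`subadditive_le_of_forall_notMem`). The linear algebra rests on the max-min characterization of the
singular values (`LinearMap.le_singularValues_of_forall_mem`).
-/

/-! ### Singular values -/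

namespace LinearMap

open Module InnerProductSpace

variable {E F G : Type*} [NormedAddCommGroup E] [InnerProductSpace ℝ E] [FiniteDimensional ℝ E]
  [NormedAddCommGroup F] [InnerProductSpace ℝ F] [FiniteDimensional ℝ F]
  [NormedAddCommGroup G] [InnerProductSpace ℝ G] [FiniteDimensional ℝ G]

/-- An orthonormal basis of right singular vectors of `T`, in the order of the singular values. -/
noncomputable def rightSingularBasis (T : E →ₗ[ℝ] F) :
    OrthonormalBasis (Fin (finrank ℝ E)) ℝ E :=
  T.isSymmetric_adjoint_comp_self.eigenvectorBasis rfl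

theorem norm_sq_apply_eq_sum (T : E →ₗ[ℝ] F) (x : E) :
    ‖T x‖ ^ 2 = ∑ j : Fin (finrank ℝ E),
      T.singularValues j ^ 2 * (T.rightSingularBasis.repr x j) ^ 2 := by
  have h1 : ‖T x‖ ^ 2 = ⟪(adjoint T ∘ₗ T) x, x⟫_ℝ := by
    rw [comp_apply, adjoint_inner_left, real_inner_self_eq_norm_sq]
  rw [h1, ← T.rightSingularBasis.repr.inner_map_map, PiLp.inner_apply]
  refine Finset.sum_congr rfl fun j _ => ?_
  have h2 : T.rightSingularBasis.repr ((adjoint T ∘ₗ T) x) j =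
      T.singularValues j ^ 2 * T.rightSingularBasis.repr x j := by
    rw [T.sq_singularValues_fin rfl j]
    exact T.isSymmetric_adjoint_comp_self.eigenvectorBasis_apply_self_apply rfl x j
  rw [h2]
  simp only [RCLike.inner_apply, conj_trivial]
  ring

theorem norm_sq_eq_sum_rightSingularBasis (T : E →ₗ[ℝ] F) (x : E) :
    ‖x‖ ^ 2 = ∑ j : Fin (finrank ℝ E), (T.rightSingularBasis.repr x j) ^ 2 := by
  rw [← T.rightSingularBasis.repr.norm_map x, EuclideanSpace.norm_sq_eq]
  simp

/-- The span of the first `k` right singular vectors. -/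
noncomputable def topSingularSpan (T : E →ₗ[ℝ] F) (k : ℕ) : Submodule ℝ E :=
  Submodule.span ℝ (Set.range fun j : {j : Fin (finrank ℝ E) // (j : ℕ) < k} =>
    T.rightSingularBasis j)

theorem finrank_topSingularSpan (T : E →ₗ[ℝ] F) {k : ℕ} (hk : k ≤ finrank ℝ E) :
    finrank ℝ (T.topSingularSpan k) = k := by
  unfold topSingularSpan
  rw [finrank_span_eq_card]
  · rw [Fintype.card_subtype, Fin.card_filter_val_lt]
    omega
  · exact T.rightSingularBasis.orthonormal.linearIndependent.comp _ Subtype.val_injective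

theorem topSingularSpan_mono (T : E →ₗ[ℝ] F) : Monotone T.topSingularSpan := by
  intro k l hkl
  refine Submodule.span_mono ?_
  rintro _ ⟨j, rfl⟩
  exact ⟨⟨j.1, j.2.trans_le hkl⟩, rfl⟩

theorem repr_eq_zero_of_mem_topSingularSpan (T : E →ₗ[ℝ] F) {k : ℕ} {x : E}
    (hx : x ∈ T.topSingularSpan k) (j : Fin (finrank ℝ E)) (hj : k ≤ j) :
    T.rightSingularBasis.repr x j = 0 := by
  unfold topSingularSpan at hx
  induction hx using Submodule.span_induction with
  | mem y hy =>
    obtain ⟨i, rfl⟩ := hy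
    have : (i : Fin (finrank ℝ E)) ≠ j := by
      rintro rfl
      exact absurd i.2 (by omega)
    simp [OrthonormalBasis.repr_self, this.symm]
  | zero => simp
  | add y z _ _ hy hz => simp [hy, hz]
  | smul a y _ hy => simp [hy]

theorem singularValues_mul_norm_le_of_mem_topSingularSpan (T : E →ₗ[ℝ] F) {i : ℕ} {x : E}
    (hx : x ∈ T.topSingularSpan (i + 1)) : T.singularValues i * ‖x‖ ≤ ‖T x‖ := by
  refine le_of_sq_le_sq ?_ (norm_nonneg _)
  rw [mul_pow, norm_sq_apply_eq_sum, T.norm_sq_eq_sum_rightSingularBasis x, Finset.mul_sum]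
  refine Finset.sum_le_sum fun j _ => ?_
  by_cases hj : i + 1 ≤ (j : ℕ)
  · simp [T.repr_eq_zero_of_mem_topSingularSpan hx j hj]
  · gcongr
    · exact T.singularValues_nonneg i
    · exact T.singularValues_antitone (by omega)

/-- The lower half of the max-min characterization of the singular values: `σ_i` dominates every
`c` for which `T` expands some subspace of dimension more than `i` by the factor `c`. -/
theorem le_singularValues_of_forall_mem (T : E →ₗ[ℝ] F) {i : ℕ} {c : ℝ} {p : Submodule ℝ E}
    (hp : i < finrank ℝ p) (h : ∀ x ∈ p, c * ‖x‖ ≤ ‖T x‖) : c ≤ T.singularValues i := by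
  have hi : i < finrank ℝ E := hp.trans_le p.finrank_le
  -- A nonzero vector of `p` that is orthogonal to the first `i` right singular vectors.
  let L : p →ₗ[ℝ] (Fin i → ℝ) := LinearMap.pi fun j =>
    (innerₗ E (T.rightSingularBasis ⟨j, j.2.trans hi⟩)) ∘ₗ p.subtype
  obtain ⟨x, hxL, hx0⟩ := (Submodule.ne_bot_iff _).1
    (LinearMap.ker_ne_bot_of_finrank_lt (f := L) (by simpa using hp))
  have hzero : ∀ j : Fin (finrank ℝ E), (j : ℕ) < i →
      T.rightSingularBasis.repr (x : E) j = 0 := by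
    intro j hj
    rw [OrthonormalBasis.repr_apply_apply]
    exact congrFun (LinearMap.mem_ker.1 hxL) ⟨j, hj⟩
  have hup : ‖T x‖ ≤ T.singularValues i * ‖(x : E)‖ := by
    refine le_of_sq_le_sq ?_ (mul_nonneg (T.singularValues_nonneg i) (norm_nonneg _))
    rw [mul_pow, norm_sq_apply_eq_sum, T.norm_sq_eq_sum_rightSingularBasis (x : E),
      Finset.mul_sum]
    refine Finset.sum_le_sum fun j _ => ?_
    by_cases hj : (j : ℕ) < i
    · simp [hzero j hj]
    · gcongr
      · exact T.singularValues_nonneg j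
      · exact T.singularValues_antitone (by omega)
  have hxpos : 0 < ‖(x : E)‖ := by simpa using hx0
  exact le_of_mul_le_mul_right ((h x x.2).trans hup) hxpos

theorem norm_apply_le_singularValues_zero (T : E →ₗ[ℝ] F) (x : E) :
    ‖T x‖ ≤ T.singularValues 0 * ‖x‖ := by
  refine le_of_sq_le_sq ?_ (mul_nonneg (T.singularValues_nonneg 0) (norm_nonneg _))
  rw [mul_pow, norm_sq_apply_eq_sum, T.norm_sq_eq_sum_rightSingularBasis x, Finset.mul_sum]
  gcongr with j
  · exact T.singularValues_nonneg j
  · exact T.singularValues_antitone (Nat.zero_le _)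

theorem singularValues_last_mul_norm_le (T : E →ₗ[ℝ] F) (x : E) :
    T.singularValues (finrank ℝ E - 1) * ‖x‖ ≤ ‖T x‖ := by
  refine le_of_sq_le_sq ?_ (norm_nonneg _)
  rw [mul_pow, norm_sq_apply_eq_sum, T.norm_sq_eq_sum_rightSingularBasis x, Finset.mul_sum]
  gcongr with j
  · exact T.singularValues_nonneg _
  · exact T.singularValues_antitone (by omega)

/-- The image under `T` of the span of the first right singular vectors of `S ∘ T` is a test
subspace for the max-min characterization. -/
theorem singularValues_comp_le (S : F →ₗ[ℝ] G) (T : E →ₗ[ℝ] F) (i : ℕ) :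
    (S ∘ₗ T).singularValues i ≤ S.singularValues i * T.singularValues 0 := by
  rcases (singularValues_nonneg (S ∘ₗ T) i).eq_or_lt with h0 | hpos
  · rw [← h0]
    exact mul_nonneg (S.singularValues_nonneg _) (T.singularValues_nonneg _)
  have hi : i < finrank ℝ E := by
    by_contra hi
    rw [singularValues_of_finrank_le _ (not_lt.1 hi)] at hpos
    exact lt_irrefl _ hpos
  set c := (S ∘ₗ T).singularValues i
  set p := (S ∘ₗ T).topSingularSpan (i + 1)
  have hp : finrank ℝ p = i + 1 := finrank_topSingularSpan _ hi
  have hbd : ∀ x ∈ p, c * ‖x‖ ≤ ‖S (T x)‖ := fun x hx =>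
    singularValues_mul_norm_le_of_mem_topSingularSpan (S ∘ₗ T) hx
  have hinj : Function.Injective (T.domRestrict p) := by
    rw [← LinearMap.ker_eq_bot, LinearMap.ker_eq_bot']
    intro x hx
    have h1 := hbd x x.2
    have hx' : T x = 0 := hx
    rw [hx', map_zero, norm_zero] at h1
    have h2 : ‖(x : E)‖ = 0 := le_antisymm (by nlinarith [norm_nonneg (x : E)]) (norm_nonneg _)
    simpa using h2
  have hpos0 : 0 < T.singularValues 0 := by
    by_contra h0
    have h0' : T.singularValues 0 = 0 := le_antisymm (not_lt.1 h0) (T.singularValues_nonneg 0)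
    have hpp : p ≠ ⊥ := by
      intro h
      rw [h, finrank_bot] at hp
      omega
    obtain ⟨x, hx, hx0⟩ := (Submodule.ne_bot_iff _).1 hpp
    have h1 := T.norm_apply_le_singularValues_zero x
    rw [h0', zero_mul] at h1
    have h2 := hbd x hx
    rw [norm_le_zero_iff.1 h1, map_zero, norm_zero] at h2
    have : 0 < ‖x‖ := norm_pos_iff.2 hx0
    nlinarith
  rw [← div_le_iff₀ hpos0]
  refine S.le_singularValues_of_forall_mem (p := (T.domRestrict p).range) ?_ ?_
  · rw [LinearMap.finrank_range_of_inj hinj, hp]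
    omega
  · rintro _ ⟨x, rfl⟩
    rw [div_mul_eq_mul_div, div_le_iff₀ hpos0]
    have h1 := T.norm_apply_le_singularValues_zero x
    have h2 := hbd x x.2
    rw [LinearMap.domRestrict_apply]
    calc c * ‖T x‖ ≤ c * (T.singularValues 0 * ‖(x : E)‖) := by gcongr
      _ = (c * ‖(x : E)‖) * T.singularValues 0 := by ring
      _ ≤ _ := by gcongr

/-- The image under `T⁻¹` of the span of the first right singular vectors of `S` is a test
subspace for the max-min characterization. -/
theorem singularValues_mul_last_le (S : E →ₗ[ℝ] G) (T : E →ₗ[ℝ] E) (hT : LinearMap.det T ≠ 0)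
    (i : ℕ) :
    S.singularValues i * T.singularValues (finrank ℝ E - 1) ≤ (S ∘ₗ T).singularValues i := by
  by_cases hi : i < finrank ℝ E
  swap
  · rw [S.singularValues_of_finrank_le (not_lt.1 hi), zero_mul]
    exact singularValues_nonneg _ _
  let e : E ≃ₗ[ℝ] E := LinearEquiv.ofIsUnitDet (f := T) (v := Module.finBasis ℝ E)
    (v' := Module.finBasis ℝ E) (by rw [LinearMap.det_toMatrix]; exact hT.isUnit)
  have he : ∀ x, e x = T x := fun x => rfl
  refine le_singularValues_of_forall_mem (S ∘ₗ T)
    (p := (S.topSingularSpan (i + 1)).map (e.symm : E →ₗ[ℝ] E)) ?_ ?_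
  · rw [LinearEquiv.finrank_map_eq, finrank_topSingularSpan _ hi]
    omega
  · rintro _ ⟨y, hy, rfl⟩
    have hTy : T (e.symm y) = y := by rw [← he, e.apply_symm_apply]
    have h1 := T.singularValues_last_mul_norm_le (e.symm y)
    have h2 := S.singularValues_mul_norm_le_of_mem_topSingularSpan hy
    rw [hTy] at h1
    simp only [LinearEquiv.coe_coe, comp_apply, hTy]
    calc _ = S.singularValues i * (T.singularValues (finrank ℝ E - 1) * ‖e.symm y‖) := by ring
      _ ≤ S.singularValues i * ‖y‖ := by
        gcongr
        exact S.singularValues_nonneg i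
      _ ≤ _ := h2

theorem singularValues_domRestrict_le (T : E →ₗ[ℝ] F) (p : Submodule ℝ E) (i : ℕ) :
    (T.domRestrict p).singularValues i ≤ T.singularValues i := by
  by_cases hi : i < finrank ℝ p
  swap
  · rw [singularValues_of_finrank_le _ (not_lt.1 hi)]
    exact singularValues_nonneg _ _
  refine T.le_singularValues_of_forall_mem
    (p := ((T.domRestrict p).topSingularSpan (i + 1)).map p.subtype) ?_ ?_
  · rw [LinearEquiv.finrank_eq (Submodule.equivMapOfInjective p.subtype p.subtype_injective
      ((T.domRestrict p).topSingularSpan (i + 1))).symm, finrank_topSingularSpan _ hi]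
    omega
  · rintro _ ⟨y, hy, rfl⟩
    exact singularValues_mul_norm_le_of_mem_topSingularSpan (T.domRestrict p) hy

theorem singularValues_le_domRestrict_topSingularSpan (T : E →ₗ[ℝ] F) {m i : ℕ} (hi : i < m)
    (hm : m ≤ finrank ℝ E) :
    T.singularValues i ≤ (T.domRestrict (T.topSingularSpan m)).singularValues i := by
  have hle : T.topSingularSpan (i + 1) ≤ T.topSingularSpan m := T.topSingularSpan_mono hi
  refine le_singularValues_of_forall_mem _
    (p := (T.topSingularSpan (i + 1)).comap (T.topSingularSpan m).subtype) ?_ ?_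
  · rw [LinearEquiv.finrank_eq (Submodule.comapSubtypeEquivOfLe hle),
      finrank_topSingularSpan _ (by omega)]
    omega
  · intro x hx
    exact T.singularValues_mul_norm_le_of_mem_topSingularSpan hx

/-- **Horn's inequality**: the product of the `m` largest singular values is submultiplicative.
On the span of the top `m` right singular vectors of `S ∘ T`, the volume factor `normDet` is
multiplicative, and restricting a map to a subspace does not increase its singular values. -/
theorem prod_singularValues_comp_le (S : F →ₗ[ℝ] G) (T : E →ₗ[ℝ] F) {m : ℕ}
    (hm : m ≤ finrank ℝ E) :
    ∏ i ∈ Finset.range m, (S ∘ₗ T).singularValues i ≤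
      (∏ i ∈ Finset.range m, S.singularValues i) * ∏ i ∈ Finset.range m, T.singularValues i := by
  set V := (S ∘ₗ T).topSingularSpan m with hV
  have hVm : finrank ℝ V = m := finrank_topSingularSpan _ hm
  have h1 : ∏ i ∈ Finset.range m, (S ∘ₗ T).singularValues i ≤
      ((S ∘ₗ T).domRestrict V).normDet := by
    rw [normDet_eq_prod_singularValues, hVm]
    refine Finset.prod_le_prod (fun i _ => singularValues_nonneg _ _) fun i hi => ?_
    exact singularValues_le_domRestrict_topSingularSpan _ (Finset.mem_range.1 hi) hm
  have h2 : (S ∘ₗ T).domRestrict V = S ∘ₗ (T.domRestrict V) := rfl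
  refine h1.trans ?_
  rw [h2, normDet_comp]
  have hS0 : 0 ≤ ∏ i ∈ Finset.range m, S.singularValues i :=
    Finset.prod_nonneg fun i _ => S.singularValues_nonneg i
  have hT0 : 0 ≤ ∏ i ∈ Finset.range m, T.singularValues i :=
    Finset.prod_nonneg fun i _ => T.singularValues_nonneg i
  by_cases h0 : (T.domRestrict V).normDet = 0
  · rw [h0, mul_zero]
    positivity
  have hrank : finrank ℝ (T.domRestrict V).range = m := by
    rw [← hVm]
    exact ((T.domRestrict V).normDet_ne_zero_tfae.out 0 2).1 h0
  refine mul_le_mul ?_ ?_ (normDet_nonneg _) hS0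
  · rw [normDet_eq_prod_singularValues, hrank]
    exact Finset.prod_le_prod (fun i _ => singularValues_nonneg _ _)
      fun i _ => S.singularValues_domRestrict_le _ i
  · rw [normDet_eq_prod_singularValues, hVm]
    exact Finset.prod_le_prod (fun i _ => singularValues_nonneg _ _)
      fun i _ => T.singularValues_domRestrict_le _ i

theorem prod_singularValues_comp_eq (S T : E →ₗ[ℝ] E) :
    ∏ i ∈ Finset.range (finrank ℝ E), (S ∘ₗ T).singularValues i =
      (∏ i ∈ Finset.range (finrank ℝ E), S.singularValues i) *
        ∏ i ∈ Finset.range (finrank ℝ E), T.singularValues i := by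
  simp only [← normDet_eq_prod_singularValues]
  exact normDet_comp_of_finrank_eq _ _ rfl

end LinearMap

/-! ### The singular value function -/

section SingularValueFunction

open Module LinearMap

variable {D : ℕ}

theorem singularValues_one_apply {i : ℕ} (hi : i < D) :
    (1 : Module.End ℝ (EuclideanSpace ℝ (Fin D))).singularValues i = 1 := by
  set T : Module.End ℝ (EuclideanSpace ℝ (Fin D)) := 1
  have hfr : finrank ℝ (EuclideanSpace ℝ (Fin D)) = D := by simp
  refine le_antisymm ?_ ?_
  · have hp : T.topSingularSpan (i + 1) ≠ ⊥ := by
      intro h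
      have := finrank_topSingularSpan T (k := i + 1) (by rw [hfr]; exact hi)
      rw [h, finrank_bot] at this
      omega
    obtain ⟨x, hx, hx0⟩ := (Submodule.ne_bot_iff _).1 hp
    have h1 := singularValues_mul_norm_le_of_mem_topSingularSpan T hx
    have hx' : 0 < ‖x‖ := norm_pos_iff.2 hx0
    have h2 : T x = x := rfl
    rw [h2] at h1
    exact le_of_mul_le_mul_right (by simpa using h1) hx'
  · refine le_singularValues_of_forall_mem T (p := ⊤) ?_ ?_
    · rw [finrank_top, hfr]
      exact hi
    · intro x _
      simp [T]

/-- The exponent of `σ_{i+1}` in `Φ^α`, as a function of `α`: it increases from `0` to `1` on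
`[i, i + 1]` and is constant elsewhere, except that the last exponent goes on increasing. -/
noncomputable def svfExponent (D : ℕ) (α : ℝ) (i : ℕ) : ℝ :=
  if i + 1 < D then max 0 (min 1 (α - i)) else max 0 (α - i)

theorem svfExponent_nonneg (D : ℕ) (α : ℝ) (i : ℕ) : 0 ≤ svfExponent D α i := by
  unfold svfExponent
  split_ifs <;> exact le_max_left _ _

theorem svfExponent_mono (D : ℕ) (i : ℕ) : Monotone fun α => svfExponent D α i := by
  intro α β h
  unfold svfExponent
  dsimp only
  split_ifs <;> gcongr

theorem sum_max_min_sub {α : ℝ} (hα : 0 ≤ α) (n : ℕ) :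
    ∑ i ∈ Finset.range n, max 0 (min 1 (α - i)) = min α n := by
  induction n with
  | zero => simp [hα]
  | succ n ih =>
    rw [Finset.sum_range_succ, ih]
    push_cast
    rcases le_total α n with h1 | h1
    · rw [min_eq_left h1, min_eq_left (by linarith : α ≤ n + 1), min_eq_right (by linarith),
        max_eq_left (by linarith)]
      ring
    · rcases le_total α (n + 1) with h2 | h2
      · rw [min_eq_right h1, min_eq_left h2, min_eq_right (by linarith), max_eq_right (by linarith)]
        ring
      · rw [min_eq_right h1, min_eq_right h2, min_eq_left (by linarith), max_eq_right (by linarith)]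

theorem sum_svfExponent (hD : 1 ≤ D) {α : ℝ} (hα : 0 ≤ α) :
    ∑ i ∈ Finset.range D, svfExponent D α i = α := by
  obtain ⟨n, rfl⟩ : ∃ n, D = n + 1 := ⟨D - 1, by omega⟩
  rw [Finset.sum_range_succ]
  have h1 : ∑ i ∈ Finset.range n, svfExponent (n + 1) α i = min α n := by
    rw [← sum_max_min_sub hα]
    refine Finset.sum_congr rfl fun i hi => ?_
    have := Finset.mem_range.1 hi
    rw [svfExponent, if_pos (by omega)]
  rw [h1, svfExponent, if_neg (by omega)]
  rcases le_total α n with h | h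
  · rw [min_eq_left h, max_eq_left (by linarith), add_zero]
  · rw [min_eq_right h, max_eq_right (by linarith)]
    ring

variable {T : Module.End ℝ (EuclideanSpace ℝ (Fin D))}

theorem singularValueFun_eq_prod (hD : 1 ≤ D) {α : ℝ} (hα : 0 ≤ α)
    (T : Module.End ℝ (EuclideanSpace ℝ (Fin D))) :
    singularValueFun α T = ∏ i ∈ Finset.range D, T.singularValues i ^ svfExponent D α i := by
  unfold singularValueFun
  split_ifs with h
  · have hm : ⌊α⌋₊ < D := (Nat.floor_lt hα).2 h
    have hm1 : (⌊α⌋₊ : ℝ) ≤ α := Nat.floor_le hα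
    have hm2 : α < ⌊α⌋₊ + 1 := Nat.lt_floor_add_one α
    have hsub : ∏ i ∈ Finset.range (⌊α⌋₊ + 1), T.singularValues i ^ svfExponent D α i =
        ∏ i ∈ Finset.range D, T.singularValues i ^ svfExponent D α i := by
      refine Finset.prod_subset (Finset.range_mono hm) fun i _ hi => ?_
      have hi' : ⌊α⌋₊ + 1 ≤ i := by simpa using hi
      have hi'' : (⌊α⌋₊ : ℝ) + 1 ≤ i := by exact_mod_cast hi'
      have h0 : svfExponent D α i = 0 := by
        unfold svfExponent
        split_ifs
        · rw [min_eq_right (by linarith), max_eq_left (by linarith)]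
        · rw [max_eq_left (by linarith)]
      rw [h0, Real.rpow_zero]
    rw [← hsub, Finset.prod_range_succ]
    congr 1
    · refine Finset.prod_congr rfl fun i hi => ?_
      have hi := Finset.mem_range.1 hi
      have hi' : (i : ℝ) + 1 ≤ ⌊α⌋₊ := by exact_mod_cast hi
      rw [svfExponent, if_pos (by omega), min_eq_left (by linarith), max_eq_right (by linarith),
        Real.rpow_one]
    · congr 1
      unfold svfExponent
      split_ifs
      · rw [min_eq_right (by linarith), max_eq_right (by linarith)]
      · rw [max_eq_right (by linarith)]
  · obtain ⟨n, rfl⟩ : ∃ n, D = n + 1 := ⟨D - 1, by omega⟩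
    push Not at h
    push_cast at h
    rw [Finset.prod_range_succ, Nat.add_sub_cancel]
    congr 1
    · refine Finset.prod_congr rfl fun i hi => ?_
      have hi := Finset.mem_range.1 hi
      have hi' : (i : ℝ) + 1 ≤ n := by exact_mod_cast hi
      rw [svfExponent, if_pos (by omega), min_eq_left (by linarith), max_eq_right (by linarith),
        Real.rpow_one]
    · rw [svfExponent, if_neg (by omega), max_eq_right (by linarith)]
      push_cast
      congr 1
      ring

theorem singularValues_pos_of_last_pos (hT : 0 < T.singularValues (D - 1)) {i : ℕ} (hi : i < D) :
    0 < T.singularValues i :=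
  hT.trans_le (T.singularValues_antitone (by omega))

theorem singularValueFun_pos (hD : 1 ≤ D) {α : ℝ} (hα : 0 ≤ α)
    (hT : 0 < T.singularValues (D - 1)) : 0 < singularValueFun α T := by
  rw [singularValueFun_eq_prod hD hα]
  exact Finset.prod_pos fun i hi =>
    Real.rpow_pos_of_pos (singularValues_pos_of_last_pos hT (Finset.mem_range.1 hi)) _

theorem singularValueFun_one (hD : 1 ≤ D) {α : ℝ} (hα : 0 ≤ α) :
    singularValueFun α (1 : Module.End ℝ (EuclideanSpace ℝ (Fin D))) = 1 := by
  rw [singularValueFun_eq_prod hD hα]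
  refine Finset.prod_eq_one fun i hi => ?_
  rw [singularValues_one_apply (Finset.mem_range.1 hi), Real.one_rpow]

theorem singularValues_zero_mul_le (S T : Module.End ℝ (EuclideanSpace ℝ (Fin D))) :
    (S * T).singularValues 0 ≤ S.singularValues 0 * T.singularValues 0 :=
  singularValues_comp_le S T 0

theorem det_ne_zero_of_last_pos (hT : 0 < T.singularValues (D - 1)) : LinearMap.det T ≠ 0 := by
  have h1 : |LinearMap.det T| = ∏ i ∈ Finset.range D, T.singularValues i := by
    rw [← normDet_eq_abs_det, normDet_eq_prod_singularValues, finrank_euclideanSpace_fin]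
  have h2 : 0 < |LinearMap.det T| := by
    rw [h1]
    exact Finset.prod_pos fun i hi => singularValues_pos_of_last_pos hT (Finset.mem_range.1 hi)
  exact abs_pos.1 h2

theorem singularValues_mul_last_le_mul (S : Module.End ℝ (EuclideanSpace ℝ (Fin D)))
    (hT : 0 < T.singularValues (D - 1)) (i : ℕ) :
    S.singularValues i * T.singularValues (D - 1) ≤ (S * T).singularValues i := by
  have := singularValues_mul_last_le S T (det_ne_zero_of_last_pos hT) i
  rwa [finrank_euclideanSpace_fin] at this

/-- Multiplying every singular value by at most `c` multiplies `Φ^α` by at most `c ^ α`. -/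
theorem singularValueFun_le_of_forall_le (hD : 1 ≤ D) {α : ℝ} (hα : 0 ≤ α)
    {S T : Module.End ℝ (EuclideanSpace ℝ (Fin D))} {c : ℝ} (hc : 0 < c)
    (h : ∀ i < D, S.singularValues i ≤ T.singularValues i * c) :
    singularValueFun α S ≤ singularValueFun α T * c ^ α := by
  rw [singularValueFun_eq_prod hD hα, singularValueFun_eq_prod hD hα]
  conv_rhs => rw [← sum_svfExponent hD hα, Real.rpow_sum_of_pos hc, sum_svfExponent hD hα,
    ← Finset.prod_mul_distrib]
  refine Finset.prod_le_prod (fun i _ => Real.rpow_nonneg (S.singularValues_nonneg i) _)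
    fun i hi => ?_
  rw [← Real.mul_rpow (T.singularValues_nonneg i) hc.le]
  exact Real.rpow_le_rpow (S.singularValues_nonneg i) (h i (Finset.mem_range.1 hi))
    (svfExponent_nonneg _ _ _)

theorem le_singularValueFun_of_forall_le (hD : 1 ≤ D) {α : ℝ} (hα : 0 ≤ α)
    {S T : Module.End ℝ (EuclideanSpace ℝ (Fin D))} {c : ℝ} (hc : 0 < c)
    (h : ∀ i < D, T.singularValues i * c ≤ S.singularValues i) :
    singularValueFun α T * c ^ α ≤ singularValueFun α S := by
  have h1 := singularValueFun_le_of_forall_le (S := T) (T := S) hD hα (inv_pos.2 hc)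
    fun i hi => by
      rw [← div_eq_mul_inv, le_div_iff₀ hc]
      exact h i hi
  rw [Real.inv_rpow hc.le, ← div_eq_mul_inv, le_div_iff₀ (Real.rpow_pos_of_pos hc α)] at h1
  exact h1

/-- Raising `α` to `β` distributes the total amount `β - α` among the exponents. -/
theorem singularValueFun_exponent_le (hD : 1 ≤ D) {α β : ℝ} (hα : 0 ≤ α) (hαβ : α ≤ β)
    (hT : 0 < T.singularValues (D - 1)) {c : ℝ} (hc : T.singularValues 0 ≤ c) :
    singularValueFun β T ≤ singularValueFun α T * c ^ (β - α) := by
  have hc0 : 0 < c := (singularValues_pos_of_last_pos hT (by omega)).trans_le hc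
  have hs : β - α = ∑ i ∈ Finset.range D, (svfExponent D β i - svfExponent D α i) := by
    rw [Finset.sum_sub_distrib, sum_svfExponent hD hα, sum_svfExponent hD (hα.trans hαβ)]
  rw [singularValueFun_eq_prod hD hα, singularValueFun_eq_prod hD (hα.trans hαβ), hs,
    Real.rpow_sum_of_pos hc0, ← Finset.prod_mul_distrib]
  refine Finset.prod_le_prod (fun i _ => Real.rpow_nonneg (T.singularValues_nonneg i) _)
    fun i hi => ?_
  have hpos := singularValues_pos_of_last_pos hT (Finset.mem_range.1 hi)
  have hle : T.singularValues i ≤ c := (T.singularValues_antitone (Nat.zero_le i)).trans hc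
  calc T.singularValues i ^ svfExponent D β i
      = T.singularValues i ^ svfExponent D α i *
        T.singularValues i ^ (svfExponent D β i - svfExponent D α i) := by
        rw [← Real.rpow_add hpos]
        congr 1
        ring
    _ ≤ _ := by
        gcongr
        exact sub_nonneg.2 (svfExponent_mono D i hαβ)

theorem le_singularValueFun_exponent (hD : 1 ≤ D) {α β : ℝ} (hα : 0 ≤ α) (hαβ : α ≤ β)
    {c : ℝ} (hc0 : 0 < c) (hc : c ≤ T.singularValues (D - 1)) :
    singularValueFun α T * c ^ (β - α) ≤ singularValueFun β T := by
  have hs : β - α = ∑ i ∈ Finset.range D, (svfExponent D β i - svfExponent D α i) := by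
    rw [Finset.sum_sub_distrib, sum_svfExponent hD hα, sum_svfExponent hD (hα.trans hαβ)]
  rw [singularValueFun_eq_prod hD hα, singularValueFun_eq_prod hD (hα.trans hαβ), hs,
    Real.rpow_sum_of_pos hc0, ← Finset.prod_mul_distrib]
  refine Finset.prod_le_prod (fun i _ => mul_nonneg
    (Real.rpow_nonneg (T.singularValues_nonneg i) _) (Real.rpow_nonneg hc0.le _)) fun i hi => ?_
  have hpos := singularValues_pos_of_last_pos (hc0.trans_le hc) (Finset.mem_range.1 hi)
  have hle : c ≤ T.singularValues i :=
    hc.trans (T.singularValues_antitone (by have := Finset.mem_range.1 hi; omega))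
  calc _ ≤ T.singularValues i ^ svfExponent D α i *
        T.singularValues i ^ (svfExponent D β i - svfExponent D α i) := by
        gcongr
        exact sub_nonneg.2 (svfExponent_mono D i hαβ)
    _ = _ := by
        rw [← Real.rpow_add hpos]
        congr 1
        ring

/-- For `α < D` the singular value function is submultiplicative: with `m = ⌊α⌋`, it is the
geometric mean of the products of the `m` and of the `m + 1` largest singular values with the
weights `m + 1 - α` and `α - m`. -/
theorem singularValueFun_mul_le {α : ℝ} (hα : 0 ≤ α) (hαD : α < D)
    (S T : Module.End ℝ (EuclideanSpace ℝ (Fin D))) :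
    singularValueFun α (S * T) ≤ singularValueFun α S * singularValueFun α T := by
  have hm : ⌊α⌋₊ < D := (Nat.floor_lt hα).2 hαD
  have ht0 : 0 ≤ α - ⌊α⌋₊ := sub_nonneg.2 (Nat.floor_le hα)
  have ht1 : 0 < 1 - (α - ⌊α⌋₊) := by linarith [Nat.lt_floor_add_one α]
  have key : ∀ R : Module.End ℝ (EuclideanSpace ℝ (Fin D)), singularValueFun α R =
      (∏ i ∈ Finset.range ⌊α⌋₊, R.singularValues i) ^ (1 - (α - ⌊α⌋₊)) *
      (∏ i ∈ Finset.range (⌊α⌋₊ + 1), R.singularValues i) ^ (α - ⌊α⌋₊) := by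
    intro R
    have h0 : 0 ≤ ∏ i ∈ Finset.range ⌊α⌋₊, R.singularValues i :=
      Finset.prod_nonneg fun i _ => R.singularValues_nonneg i
    rw [Finset.prod_range_succ, Real.mul_rpow h0 (R.singularValues_nonneg _), ← mul_assoc,
      ← Real.rpow_add_of_nonneg h0 ht1.le ht0, sub_add_cancel, Real.rpow_one, singularValueFun,
      if_pos hαD]
  have hn : ∀ (R : Module.End ℝ (EuclideanSpace ℝ (Fin D))) (k : ℕ),
      0 ≤ ∏ i ∈ Finset.range k, R.singularValues i :=
    fun R k => Finset.prod_nonneg fun i _ => R.singularValues_nonneg i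
  rw [key, key S, key T]
  have h1 := prod_singularValues_comp_le S T (m := ⌊α⌋₊) (by simpa using hm.le)
  have h2 := prod_singularValues_comp_le S T (m := ⌊α⌋₊ + 1) (by simpa using hm)
  calc _ ≤ ((∏ i ∈ Finset.range ⌊α⌋₊, S.singularValues i) *
          ∏ i ∈ Finset.range ⌊α⌋₊, T.singularValues i) ^ (1 - (α - ⌊α⌋₊)) *
        ((∏ i ∈ Finset.range (⌊α⌋₊ + 1), S.singularValues i) *
          ∏ i ∈ Finset.range (⌊α⌋₊ + 1), T.singularValues i) ^ (α - ⌊α⌋₊) :=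
        mul_le_mul (Real.rpow_le_rpow (hn _ _) h1 ht1.le) (Real.rpow_le_rpow (hn _ _) h2 ht0)
          (Real.rpow_nonneg (hn _ _) _)
          (Real.rpow_nonneg (mul_nonneg (hn _ _) (hn _ _)) _)
    _ = _ := by
        rw [Real.mul_rpow (hn _ _) (hn _ _), Real.mul_rpow (hn _ _) (hn _ _)]
        ring

/-- For `α ≥ D` the singular value function is supermultiplicative: it is the product of the
multiplicative function `|det|` and of a nonnegative power of the smallest singular value. -/
theorem le_singularValueFun_mul (hD : 1 ≤ D) {α : ℝ} (hαD : D ≤ α)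
    {S T : Module.End ℝ (EuclideanSpace ℝ (Fin D))}
    (hS : 0 < S.singularValues (D - 1)) (hT : 0 < T.singularValues (D - 1)) :
    singularValueFun α S * singularValueFun α T ≤ singularValueFun α (S * T) := by
  have hST := singularValues_mul_last_le_mul S hT (D - 1)
  have hST0 := (mul_pos hS hT).trans_le hST
  have key : ∀ R : Module.End ℝ (EuclideanSpace ℝ (Fin D)), 0 < R.singularValues (D - 1) →
      singularValueFun α R = (∏ i ∈ Finset.range D, R.singularValues i) *
        R.singularValues (D - 1) ^ (α - D) := by
    intro R hR
    have hprod := Finset.prod_range_succ (fun i => R.singularValues i) (D - 1)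
    rw [show D - 1 + 1 = D by omega] at hprod
    rw [hprod, singularValueFun, if_neg (not_lt.2 hαD), Real.rpow_add_one hR.ne']
    ring
  have hdet := prod_singularValues_comp_eq S T
  rw [finrank_euclideanSpace_fin] at hdet
  rw [key S hS, key T hT, key _ hST0]
  change _ ≤ (∏ i ∈ Finset.range D, (S ∘ₗ T).singularValues i) * _
  rw [hdet, mul_mul_mul_comm, ← Real.mul_rpow hS.le hT.le]
  exact mul_le_mul_of_nonneg_left
    (Real.rpow_le_rpow (mul_pos hS hT).le hST (sub_nonneg.2 hαD))
    (mul_nonneg (Finset.prod_nonneg fun i _ => S.singularValues_nonneg i)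
      (Finset.prod_nonneg fun i _ => T.singularValues_nonneg i))

end SingularValueFunction

/-! ### Ergodic theorems -/

section ErgodicTheorems

open MeasureTheory Filter Topology

theorem tendsto_div_nat_of_forall_eventually {u : ℕ → ℝ} {γ : ℝ}
    (h : ∀ k : ℕ, ∀ᶠ n : ℕ in atTop,
      (γ - 1 / ((k : ℝ) + 1)) * n ≤ u n ∧ u n ≤ (γ + 1 / ((k : ℝ) + 1)) * n) :
    Tendsto (fun n : ℕ => u n / n) atTop (𝓝 γ) := by
  rw [Metric.tendsto_atTop']
  intro ε hε
  obtain ⟨k, hk⟩ := exists_nat_one_div_lt hε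
  obtain ⟨N, hN⟩ := eventually_atTop.1 (h k)
  refine ⟨N, fun n hn => ?_⟩
  obtain ⟨h1, h2⟩ := hN n hn.le
  have hn0 : (0 : ℝ) < n := by
    have : 0 < n := by omega
    exact_mod_cast this
  rw [← le_div_iff₀ hn0] at h1
  rw [← div_le_iff₀ hn0] at h2
  rw [Real.dist_eq, abs_lt]
  constructor <;> linarith

theorem eventually_add_const_le_mul {a b : ℝ} (hab : a < b) (K : ℝ) :
    ∀ᶠ n : ℕ in atTop, a * n + K ≤ b * n := by
  have h : Tendsto (fun n : ℕ => (b - a) * (n : ℝ)) atTop atTop :=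
    tendsto_natCast_atTop_atTop.const_mul_atTop (sub_pos.2 hab)
  filter_upwards [h.eventually_ge_atTop K] with n hn
  linarith

variable {X : Type*}

/-- The maximum of `0, S₁ f, …, Sₙ f`, where `S_k f` are the Birkhoff sums of `f` along `T`, defined
by the recursion `M_{n+1} = max 0 (f + M_n ∘ T)`. -/
def maxBirkhoffSum (T : X → X) (f : X → ℝ) : ℕ → X → ℝ
  | 0, _ => 0
  | n + 1, x => max 0 (f x + maxBirkhoffSum T f n (T x))

theorem maxBirkhoffSum_nonneg (T : X → X) (f : X → ℝ) (n : ℕ) (x : X) :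
    0 ≤ maxBirkhoffSum T f n x := by
  cases n with
  | zero => exact le_rfl
  | succ n => exact le_max_left _ _

theorem maxBirkhoffSum_mono (T : X → X) (f : X → ℝ) (x : X) :
    Monotone fun n => maxBirkhoffSum T f n x := by
  refine monotone_nat_of_le_succ fun n => ?_
  induction n generalizing x with
  | zero => exact maxBirkhoffSum_nonneg _ _ _ _
  | succ n ih => exact max_le_max le_rfl (by simpa using ih (T x))

theorem birkhoffSum_le_maxBirkhoffSum (T : X → X) (f : X → ℝ) (n : ℕ) (x : X) :
    birkhoffSum T f n x ≤ maxBirkhoffSum T f n x := by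
  induction n generalizing x with
  | zero => simp [maxBirkhoffSum]
  | succ n ih =>
    rw [birkhoffSum_succ']
    exact (add_le_add le_rfl (ih (T x))).trans (le_max_right _ _)

theorem bddAbove_maxBirkhoffSum_comp_iff (T : X → X) (f : X → ℝ) (x : X) :
    (∃ K : ℕ, ∀ n, maxBirkhoffSum T f n (T x) ≤ K) ↔ ∃ K : ℕ, ∀ n, maxBirkhoffSum T f n x ≤ K := by
  constructor
  · rintro ⟨K, hK⟩
    obtain ⟨L, hL⟩ := exists_nat_ge (max 0 (f x + K))
    refine ⟨L, fun n => ?_⟩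
    cases n with
    | zero => exact Nat.cast_nonneg L
    | succ n => exact (max_le_max le_rfl (by linarith [hK n])).trans hL
  · rintro ⟨K, hK⟩
    obtain ⟨L, hL⟩ := exists_nat_ge (K - f x)
    refine ⟨L, fun n => ?_⟩
    have h1 : f x + maxBirkhoffSum T f n (T x) ≤ maxBirkhoffSum T f (n + 1) x := le_max_right _ _
    linarith [hK (n + 1)]

/-- The covering argument for the upper bound in Kingman's theorem. If every point outside `B`
starts an orbit segment of length `l ∈ [1, K]` on which `h` has slope at most `a ≤ 0`, then an orbit
segment of length `n` is covered by such segments, apart from its visits to `B` and its last `K`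
points. -/
theorem subadditive_le_of_forall_notMem {T : X → X} {h : ℕ → X → ℝ} (hnonpos : ∀ n x, h n x ≤ 0)
    (hsub : ∀ m n x, h (m + n) x ≤ h m x + h n (T^[m] x)) {a : ℝ} (ha : a ≤ 0) {K : ℕ} {B : Set X}
    (hB : ∀ y ∉ B, ∃ l, 1 ≤ l ∧ l ≤ K ∧ h l y ≤ a * l) (n : ℕ) (y : X) :
    h n y ≤ a * n - a * K - a * birkhoffSum T (B.indicator 1) n y := by
  induction n using Nat.strong_induction_on generalizing y with
  | _ n ih =>
  have hS : ∀ m z, 0 ≤ birkhoffSum T (B.indicator (1 : X → ℝ)) m z := fun m z =>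
    Finset.sum_nonneg fun i _ => Set.indicator_nonneg (fun _ _ => zero_le_one) _
  rcases le_or_gt n K with hn | hn
  · have h1 := hnonpos n y
    have h2 : (n : ℝ) ≤ K := by exact_mod_cast hn
    nlinarith [hS n y, mul_nonneg (neg_nonneg.2 ha) (hS n y),
      mul_nonneg (neg_nonneg.2 ha) (sub_nonneg.2 h2)]
  by_cases hy : y ∈ B
  · obtain ⟨m, rfl⟩ : ∃ m, n = 1 + m := ⟨n - 1, by omega⟩
    have h1 := hsub 1 m y
    have h2 := ih m (by omega) (T y)
    have h3 := hnonpos 1 y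
    have h4 := birkhoffSum_add T (B.indicator (1 : X → ℝ)) 1 m y
    rw [birkhoffSum_one, Set.indicator_of_mem hy, Pi.one_apply] at h4
    simp only [Function.iterate_one] at h1 h4
    rw [h4]
    push_cast
    linarith
  · obtain ⟨l, hl1, hlK, hl⟩ := hB y hy
    obtain ⟨m, rfl⟩ : ∃ m, n = l + m := ⟨n - l, by omega⟩
    have h1 := hsub l m y
    have h2 := ih m (by omega) (T^[l] y)
    rw [birkhoffSum_add T (B.indicator (1 : X → ℝ)) l m y]
    push_cast
    nlinarith [mul_nonneg (neg_nonneg.2 ha) (hS l y)]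

variable [MeasurableSpace X] {T : X → X} {f : X → ℝ}

theorem measurable_maxBirkhoffSum (hT : Measurable T) (hf : Measurable f) (n : ℕ) :
    Measurable (maxBirkhoffSum T f n) := by
  induction n with
  | zero => exact measurable_const
  | succ n ih => exact measurable_const.max (hf.add (ih.comp hT))

theorem measurable_birkhoffSum (hT : Measurable T) (hf : Measurable f) (n : ℕ) :
    Measurable (birkhoffSum T f n) := by
  unfold birkhoffSum
  exact Finset.measurable_sum _ fun i _ => hf.comp (hT.iterate i)

variable {μ : Measure X}

theorem integrable_maxBirkhoffSum (hT : MeasurePreserving T μ μ) (hfi : Integrable f μ) (n : ℕ) :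
    Integrable (maxBirkhoffSum T f n) μ := by
  induction n with
  | zero => exact integrable_zero _ _ _
  | succ n ih =>
    have h := (integrable_zero X ℝ μ).sup (hfi.add (hT.integrable_comp_of_integrable ih))
    exact h

/-- If `∫ f < 0`, then the Birkhoff sums of `f` are almost surely bounded above. Otherwise, by
ergodicity, the running maxima `M_n` tend to infinity almost surely; then
`M_{n+1} - M_n ∘ T = max (-(M_n ∘ T)) f` tends to `f`, while its integral `∫ M_{n+1} - ∫ M_n` is
nonnegative. -/
theorem Ergodic.ae_bddAbove_maxBirkhoffSum (hT : Ergodic T μ) (hf : Measurable f)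
    (hfi : Integrable f μ) (hneg : ∫ x, f x ∂μ < 0) :
    ∀ᵐ x ∂μ, ∃ K : ℕ, ∀ n, maxBirkhoffSum T f n x ≤ K := by
  set A : Set X := {x | ∃ K : ℕ, ∀ n, maxBirkhoffSum T f n x ≤ K} with hA
  have hAm : MeasurableSet A := by
    have : A = ⋃ K : ℕ, ⋂ n, {x | maxBirkhoffSum T f n x ≤ K} := by
      ext x
      simp [hA]
    rw [this]
    exact MeasurableSet.iUnion fun K => MeasurableSet.iInter fun n =>
      measurableSet_le (measurable_maxBirkhoffSum hT.measurable hf n) measurable_const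
  have hAinv : T ⁻¹' A = A := by
    ext x
    exact bddAbove_maxBirkhoffSum_comp_iff T f x
  rcases hT.toPreErgodic.ae_mem_or_ae_notMem hAm hAinv with h | h
  · exact h
  exfalso
  have hMi := integrable_maxBirkhoffSum hT.toMeasurePreserving hfi
  have hlim : Tendsto (fun n => ∫ x, max (-maxBirkhoffSum T f n (T x)) (f x) ∂μ) atTop
      (𝓝 (∫ x, f x ∂μ)) := by
    refine tendsto_integral_of_dominated_convergence (fun x => |f x|) (fun n => ?_) hfi.abs
      (fun n => ?_) ?_
    · exact (((measurable_maxBirkhoffSum hT.measurable hf n).comp hT.measurable).neg.max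
        hf).aestronglyMeasurable
    · refine ae_of_all _ fun x => ?_
      rw [Real.norm_eq_abs]
      refine abs_le.2 ⟨(neg_abs_le _).trans (le_max_right _ _), max_le ?_ (le_abs_self _)⟩
      linarith [maxBirkhoffSum_nonneg T f n (T x), abs_nonneg (f x)]
    · filter_upwards [h] with x hx
      rw [← hAinv] at hx
      have hx' : ∀ K : ℕ, ∃ n, (K : ℝ) < maxBirkhoffSum T f n (T x) := by
        simpa [hA] using hx
      obtain ⟨K, hK⟩ := exists_nat_ge (-f x)
      obtain ⟨N, hN⟩ := hx' K
      refine tendsto_const_nhds.congr' ?_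
      filter_upwards [eventually_ge_atTop N] with n hn
      have := maxBirkhoffSum_mono T f (T x) hn
      rw [max_eq_right]
      dsimp only at this
      linarith
  have hnn : ∀ n, 0 ≤ ∫ x, max (-maxBirkhoffSum T f n (T x)) (f x) ∂μ := by
    intro n
    have h1 : ∀ x, max (-maxBirkhoffSum T f n (T x)) (f x) =
        maxBirkhoffSum T f (n + 1) x - maxBirkhoffSum T f n (T x) := by
      intro x
      rw [maxBirkhoffSum, max_sub_sub_right 0 _ _ |>.symm]
      congr 1 <;> ring
    simp_rw [h1]
    have h2 : ∫ x, maxBirkhoffSum T f n (T x) ∂μ = ∫ x, maxBirkhoffSum T f n x ∂μ := by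
      have h3 := integral_map (μ := μ) hT.measurable.aemeasurable
        (f := maxBirkhoffSum T f n)
        (measurable_maxBirkhoffSum hT.measurable hf n).aestronglyMeasurable
      rw [hT.map_eq] at h3
      exact h3.symm
    have h4 : Integrable (fun x => maxBirkhoffSum T f n (T x)) μ :=
      hT.toMeasurePreserving.integrable_comp_of_integrable (hMi n)
    rw [integral_sub (hMi (n + 1)) h4, h2, sub_nonneg]
    exact integral_mono (hMi n) (hMi (n + 1)) fun x => maxBirkhoffSum_mono T f x (Nat.le_succ n)
  exact absurd (ge_of_tendsto' hlim hnn) (not_le.2 hneg)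

variable [IsProbabilityMeasure μ]

theorem Ergodic.ae_eventually_birkhoffSum_le (hT : Ergodic T μ) (hf : Measurable f)
    (hfi : Integrable f μ) {c : ℝ} (hc : ∫ x, f x ∂μ < c) :
    ∀ᵐ x ∂μ, ∀ᶠ n : ℕ in atTop, birkhoffSum T f n x ≤ c * n := by
  obtain ⟨b, hb1, hb2⟩ := exists_between hc
  have hneg : ∫ x, (f x - b) ∂μ < 0 := by
    rw [integral_sub hfi (integrable_const b), integral_const]
    simpa using hb1
  filter_upwards [hT.ae_bddAbove_maxBirkhoffSum (hf.sub_const b)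
    (hfi.sub (integrable_const b)) hneg] with x hx
  obtain ⟨K, hK⟩ := hx
  filter_upwards [eventually_add_const_le_mul hb2 K] with n hn
  have h1 := (birkhoffSum_le_maxBirkhoffSum T (fun x => f x - b) n x).trans (hK n)
  have h2 : birkhoffSum T (fun x => f x - b) n x = birkhoffSum T f n x - n * b := by
    simp [birkhoffSum, Finset.sum_sub_distrib]
  rw [h2] at h1
  linarith

/-- **Birkhoff's pointwise ergodic theorem** for an ergodic transformation. -/
theorem Ergodic.ae_tendsto_birkhoffSum_div (hT : Ergodic T μ) (hf : Measurable f)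
    (hfi : Integrable f μ) :
    ∀ᵐ x ∂μ, Tendsto (fun n : ℕ => birkhoffSum T f n x / n) atTop (𝓝 (∫ x, f x ∂μ)) := by
  have h1 : ∀ᵐ x ∂μ, ∀ k : ℕ, ∀ᶠ n : ℕ in atTop,
      birkhoffSum T f n x ≤ (∫ x, f x ∂μ + 1 / ((k : ℝ) + 1)) * n :=
    ae_all_iff.2 fun k => hT.ae_eventually_birkhoffSum_le hf hfi
      (lt_add_of_pos_right _ Nat.one_div_pos_of_nat)
  have h2 : ∀ᵐ x ∂μ, ∀ k : ℕ, ∀ᶠ n : ℕ in atTop,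
      birkhoffSum T (fun x => -f x) n x ≤ (-∫ x, f x ∂μ + 1 / ((k : ℝ) + 1)) * n :=
    ae_all_iff.2 fun k => hT.ae_eventually_birkhoffSum_le hf.neg hfi.neg (by
      rw [integral_neg']
      exact lt_add_of_pos_right _ Nat.one_div_pos_of_nat)
  filter_upwards [h1, h2] with x hx1 hx2
  refine tendsto_div_nat_of_forall_eventually fun k => ?_
  filter_upwards [hx1 k, hx2 k] with n hn1 hn2
  have h3 : birkhoffSum T (fun x => -f x) n x = -birkhoffSum T f n x := by
    simp [birkhoffSum]
  rw [h3] at hn2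
  exact ⟨by linarith, hn1⟩

theorem Ergodic.ae_eventually_le_of_subadditive (hT : Ergodic T μ) {h : ℕ → X → ℝ}
    (hm : ∀ n, Measurable (h n)) (hnonpos : ∀ n x, h n x ≤ 0)
    (hsub : ∀ m n x, h (m + n) x ≤ h m x + h n (T^[m] x)) {a b : ℝ} (hab : a < b)
    (ha : ∀ᵐ x ∂μ, ∃ n : ℕ, 1 ≤ n ∧ h n x ≤ a * n) :
    ∀ᵐ x ∂μ, ∀ᶠ n : ℕ in atTop, h n x ≤ b * n := by
  rcases le_or_gt 0 b with hb | hb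
  · exact ae_of_all _ fun x => Eventually.of_forall fun n => (hnonpos n x).trans (by positivity)
  have ha0 : a < 0 := hab.trans hb
  let B : ℕ → Set X := fun K => {y | ∀ l, 1 ≤ l → l ≤ K → a * l < h l y}
  have hBm : ∀ K, MeasurableSet (B K) := by
    intro K
    have : B K = ⋂ l, ⋂ (_ : 1 ≤ l), ⋂ (_ : l ≤ K), {y | a * l < h l y} := by
      ext y
      simp [B]
    rw [this]
    exact MeasurableSet.iInter fun l => MeasurableSet.iInter fun _ => MeasurableSet.iInter fun _ =>
      measurableSet_lt measurable_const (hm l)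
  have hBanti : Antitone B := fun K L hKL y hy l h1 h2 => hy l h1 (h2.trans hKL)
  have hBlim : Tendsto (fun K => μ (B K)) atTop (𝓝 0) := by
    have h1 := tendsto_measure_iInter_atTop (μ := μ) (fun K => (hBm K).nullMeasurableSet) hBanti
      ⟨0, measure_ne_top _ _⟩
    have h2 : μ (⋂ K, B K) = 0 := by
      refine measure_mono_null (fun y hy => ?_) ha
      rintro ⟨n, hn1, hn⟩
      exact absurd (Set.mem_iInter.1 hy n n hn1 le_rfl) (not_lt.2 hn)
    rwa [h2] at h1
  -- `δ` is chosen so that `a * (1 - δ) < b`.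
  obtain ⟨δ, hδ0, hδ⟩ : ∃ δ : ℝ, 0 < δ ∧ a - a * δ < b :=
    ⟨(b - a) / (-2 * a), div_pos (by linarith) (by linarith), by
      have : a * ((b - a) / (-2 * a)) = -(b - a) / 2 := by
        field_simp [ha0.ne]
      rw [this]
      linarith⟩
  obtain ⟨K, hK⟩ := (hBlim.eventually (gt_mem_nhds (ENNReal.ofReal_pos.2 hδ0))).exists
  have hint : ∫ x, (B K).indicator (1 : X → ℝ) x ∂μ < δ := by
    rw [integral_indicator_one (hBm K)]
    exact (ENNReal.lt_ofReal_iff_toReal_lt (measure_ne_top _ _)).1 hK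
  filter_upwards [hT.ae_eventually_birkhoffSum_le (measurable_one.indicator (hBm K))
    ((integrable_const (1 : ℝ)).indicator (hBm K)) hint] with x hx
  filter_upwards [hx, eventually_add_const_le_mul hδ (-a * K)] with n hn1 hn2
  have h1 := subadditive_le_of_forall_notMem (T := T) hnonpos hsub ha0.le (K := K) (B := B K)
    (fun y hy => by simpa [B] using hy) n x
  nlinarith [mul_le_mul_of_nonneg_left hn1 (neg_nonneg.2 ha0.le)]

/-- Kingman's theorem for nonpositive subadditive sequences. -/
theorem Ergodic.exists_ae_tendsto_div_of_subadditive_of_nonpos (hT : Ergodic T μ)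
    {h : ℕ → X → ℝ} (hm : ∀ n, Measurable (h n)) (hnonpos : ∀ n x, h n x ≤ 0)
    (hsub : ∀ m n x, h (m + n) x ≤ h m x + h n (T^[m] x)) {c : ℝ}
    (hc : ∀ᵐ x ∂μ, ∀ᶠ n : ℕ in atTop, c * n ≤ h n x) :
    ∃ γ : ℝ, ∀ᵐ x ∂μ, Tendsto (fun n : ℕ => h n x / n) atTop (𝓝 γ) := by
  -- The additive constant gives `T ⁻¹' E q ⊆ E q`; it does not matter for the growth rate.
  let E : ℝ → Set X := fun q => {x | ∃ C : ℕ, ∃ᶠ n : ℕ in atTop, h n x ≤ q * n + C}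
  have hEm : ∀ q, MeasurableSet (E q) := by
    intro q
    have : E q = ⋃ C : ℕ, ⋂ N : ℕ, ⋃ n : ℕ, ⋃ (_ : N ≤ n), {x | h n x ≤ q * n + C} := by
      ext x
      simp [E, frequently_atTop]
    rw [this]
    exact MeasurableSet.iUnion fun C => MeasurableSet.iInter fun N => MeasurableSet.iUnion fun n =>
      MeasurableSet.iUnion fun _ => measurableSet_le (hm n) measurable_const
  have hEinv : ∀ q, T ⁻¹' E q ⊆ E q := by
    rintro q x ⟨C, hC⟩
    obtain ⟨L, hL⟩ := exists_nat_ge (C - q)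
    refine ⟨L, ?_⟩
    rw [frequently_atTop] at hC ⊢
    intro N
    obtain ⟨n, hn, hle⟩ := hC N
    refine ⟨1 + n, by omega, ?_⟩
    have h1 := hsub 1 n x
    have h2 := hnonpos 1 x
    simp only [Function.iterate_one] at h1
    push_cast
    linarith
  have hE01 : ∀ q, (∀ᵐ x ∂μ, x ∈ E q) ∨ ∀ᵐ x ∂μ, x ∉ E q := by
    intro q
    rcases hT.ae_empty_or_univ_of_preimage_ae_le (hEm q).nullMeasurableSet
      (LE.le.eventuallyLE (hEinv q)) with h | h
    · exact Or.inr (eventuallyEq_empty.1 h)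
    · exact Or.inl (eventuallyEq_univ.1 h)
  let A : Set ℝ := {q | ∀ᵐ x ∂μ, x ∈ E q}
  have hA0 : (0 : ℝ) ∈ A := ae_of_all _ fun x => ⟨0, Eventually.frequently
    (Eventually.of_forall fun n => by simpa using hnonpos n x)⟩
  have hAb : BddBelow A := by
    refine ⟨c, fun q hq => ?_⟩
    by_contra hqc
    have hq' : ∀ᵐ x ∂μ, x ∈ E q := hq
    obtain ⟨x, ⟨C, hx1⟩, hx2⟩ := (hq'.and hc).exists
    obtain ⟨n, hn1, hn2, hn3⟩ := (hx1.and_eventually (hx2.and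
      (eventually_add_const_le_mul (not_le.1 hqc) (C + 1)))).exists
    linarith
  have hlow : ∀ q < sInf A, ∀ᵐ x ∂μ, ∀ᶠ n : ℕ in atTop, q * n ≤ h n x := by
    intro q hq
    have hqA : q ∉ A := notMem_of_lt_csInf hq hAb
    filter_upwards [(hE01 q).resolve_left hqA] with x hx
    have h1 : ¬∃ᶠ n : ℕ in atTop, h n x ≤ q * n + (0 : ℕ) := fun hf => hx ⟨0, hf⟩
    filter_upwards [not_frequently.1 h1] with n hn
    push Not at hn
    simpa using hn.le
  have hup : ∀ q, sInf A < q → ∀ᵐ x ∂μ, ∀ᶠ n : ℕ in atTop, h n x ≤ q * n := by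
    intro q hq
    obtain ⟨r, hrA, hr⟩ := exists_lt_of_csInf_lt ⟨0, hA0⟩ hq
    obtain ⟨s, hrs, hsq⟩ := exists_between hr
    refine hT.ae_eventually_le_of_subadditive hm hnonpos hsub hsq ?_
    filter_upwards [hrA] with x hx
    obtain ⟨C, hC⟩ := hx
    obtain ⟨n, hn1, hn2, hn3⟩ := (hC.and_eventually
      ((eventually_add_const_le_mul hrs C).and (eventually_ge_atTop 1))).exists
    exact ⟨n, hn3, hn1.trans hn2⟩
  refine ⟨sInf A, ?_⟩
  filter_upwards [ae_all_iff.2 fun k : ℕ => hlow (sInf A - 1 / ((k : ℝ) + 1))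
      (sub_lt_self _ Nat.one_div_pos_of_nat),
    ae_all_iff.2 fun k : ℕ => hup (sInf A + 1 / ((k : ℝ) + 1))
      (lt_add_of_pos_right _ Nat.one_div_pos_of_nat)] with x hx1 hx2
  exact tendsto_div_nat_of_forall_eventually fun k => (hx1 k).and (hx2 k)

/-- **Kingman's subadditive ergodic theorem** for an ergodic transformation, in the case of a
sequence dominated by the Birkhoff sums of an integrable function `φ`. Subtracting these Birkhoff
sums makes the sequence nonpositive. -/
theorem Ergodic.exists_ae_tendsto_div_of_subadditive (hT : Ergodic T μ) {g : ℕ → X → ℝ}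
    (hm : ∀ n, Measurable (g n)) (hsub : ∀ m n x, g (m + n) x ≤ g m x + g n (T^[m] x))
    {φ : X → ℝ} (hφ : Measurable φ) (hφi : Integrable φ μ)
    (hbd : ∀ n x, |g n x| ≤ birkhoffSum T φ n x) :
    ∃ γ : ℝ, ∀ᵐ x ∂μ, Tendsto (fun n : ℕ => g n x / n) atTop (𝓝 γ) := by
  obtain ⟨γ, hγ⟩ := hT.exists_ae_tendsto_div_of_subadditive_of_nonpos
    (h := fun n x => g n x - birkhoffSum T φ n x) (c := -2 * (∫ x, φ x ∂μ + 1))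
    (fun n => (hm n).sub (measurable_birkhoffSum hT.measurable hφ n))
    (fun n x => sub_nonpos.2 ((le_abs_self _).trans (hbd n x)))
    (fun m n x => by
      rw [birkhoffSum_add]
      linarith [hsub m n x])
    (by
      filter_upwards [hT.ae_eventually_birkhoffSum_le hφ hφi (lt_add_one _)] with x hx
      filter_upwards [hx] with n hn
      linarith [(abs_le.1 (hbd n x)).1])
  refine ⟨γ + ∫ x, φ x ∂μ, ?_⟩
  filter_upwards [hγ, hT.ae_tendsto_birkhoffSum_div hφ hφi] with x hx1 hx2
  refine (hx1.add hx2).congr fun n => ?_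
  ring

end ErgodicTheorems

/-! ### Level sums of a code tree -/

namespace CodeTree

variable {Λ : Type*} {D : ℕ} {F : AffineIFSFamily Λ D} (ω : CodeTree F)

theorem mem_nodes_of_append {u v : List ℕ} (h : u ++ v ∈ ω.nodes) : u ∈ ω.nodes := by
  induction v using List.reverseRecOn with
  | nil => simpa using h
  | append_singleton v l ih =>
    rw [← List.append_assoc] at h
    obtain ⟨a, ha, -⟩ := (ω.child _ _).1 h
    exact ih (by simp [nodes, Option.mem_def.1 ha])

theorem concat_mem_level {v : List ℕ} {k l : ℕ} :
    v ++ [l] ∈ ω.level (k + 1) ↔ v ∈ ω.level k ∧ ∃ a ∈ ω.label v, l < F.numMaps a := by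
  constructor
  · rintro ⟨h1, h2⟩
    exact ⟨⟨ω.mem_nodes_of_append h1, by simpa using h2⟩, (ω.child v l).1 h1⟩
  · rintro ⟨⟨-, h1⟩, h2⟩
    exact ⟨(ω.child v l).2 h2, by simpa using h1⟩

theorem exists_eq_concat_of_mem_level_succ {w : List ℕ} {k : ℕ} (hw : w ∈ ω.level (k + 1)) :
    ∃ v l, w = v ++ [l] := by
  rcases List.eq_nil_or_concat w with rfl | ⟨v, l, rfl⟩
  · simp [level] at hw
  · exact ⟨v, l, List.concat_eq_append⟩

theorem linFrom_append (w u v : List ℕ) :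
    ω.linFrom w (u ++ v) = ω.linFrom w u * ω.linFrom (w ++ u) v := by
  induction u generalizing w with
  | nil => simp [linFrom]
  | cons i u ih => simp [linFrom, ih, mul_assoc]

theorem wordLin_concat (v : List ℕ) (l : ℕ) :
    ω.wordLin (v ++ [l]) = ω.wordLin v * ω.stepLin v l := by
  simp [wordLin, linFrom_append, linFrom]

theorem level_zero : ω.level 0 = {[]} := by
  ext w
  constructor
  · rintro ⟨-, h⟩
    simpa using h
  · rintro rfl
    exact ⟨ω.root, rfl⟩

section Bounds

variable {σlo σhi : ℝ}

theorem stepLin_bounds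
    (hσ : ∀ (l : Λ) (i : Fin (F.numMaps l)),
      σlo ≤ (F.lin l i).singularValues (D - 1) ∧ (F.lin l i).singularValues 0 ≤ σhi)
    {v : List ℕ} {l : ℕ} (h : ∃ a ∈ ω.label v, l < F.numMaps a) :
    σlo ≤ (ω.stepLin v l).singularValues (D - 1) ∧ (ω.stepLin v l).singularValues 0 ≤ σhi := by
  obtain ⟨a, ha, hl⟩ := h
  have : ω.stepLin v l = F.lin a ⟨l, hl⟩ := by
    simp [stepLin, Option.mem_def.1 ha, hl]
  rw [this]
  exact hσ a ⟨l, hl⟩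

theorem wordLin_bounds (hD : 1 ≤ D) (hlo : 0 < σlo)
    (hσ : ∀ (l : Λ) (i : Fin (F.numMaps l)),
      σlo ≤ (F.lin l i).singularValues (D - 1) ∧ (F.lin l i).singularValues 0 ≤ σhi)
    {k : ℕ} {w : List ℕ} (hw : w ∈ ω.level k) :
    σlo ^ k ≤ (ω.wordLin w).singularValues (D - 1) ∧
      (ω.wordLin w).singularValues 0 ≤ σhi ^ k := by
  induction k generalizing w with
  | zero =>
    rw [level_zero, Set.mem_singleton_iff] at hw
    subst hw
    have h1 : ω.wordLin [] = 1 := rfl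
    rw [h1, singularValues_one_apply (by omega), singularValues_one_apply (by omega)]
    simp
  | succ k ih =>
    obtain ⟨v, l, rfl⟩ := ω.exists_eq_concat_of_mem_level_succ hw
    obtain ⟨hv, hl⟩ := ω.concat_mem_level.1 hw
    obtain ⟨h1, h2⟩ := ih hv
    obtain ⟨h3, h4⟩ := ω.stepLin_bounds hσ hl
    rw [wordLin_concat, pow_succ, pow_succ]
    constructor
    · refine le_trans ?_ (singularValues_mul_last_le_mul _ (hlo.trans_le h3) _)
      exact mul_le_mul h1 h3 hlo.le (LinearMap.singularValues_nonneg _ _)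
    · refine (singularValues_zero_mul_le _ _).trans ?_
      exact mul_le_mul h2 h4 (LinearMap.singularValues_nonneg _ _)
        ((LinearMap.singularValues_nonneg _ _).trans h2)

theorem wordLin_last_pos (hD : 1 ≤ D) (hlo : 0 < σlo)
    (hσ : ∀ (l : Λ) (i : Fin (F.numMaps l)),
      σlo ≤ (F.lin l i).singularValues (D - 1) ∧ (F.lin l i).singularValues 0 ≤ σhi)
    {k : ℕ} {w : List ℕ} (hw : w ∈ ω.level k) :
    0 < (ω.wordLin w).singularValues (D - 1) :=
  (pow_pos hlo k).trans_le (ω.wordLin_bounds hD hlo hσ hw).1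

theorem levelSum_pos (hD : 1 ≤ D) (hlo : 0 < σlo)
    (hσ : ∀ (l : Λ) (i : Fin (F.numMaps l)),
      σlo ≤ (F.lin l i).singularValues (D - 1) ∧ (F.lin l i).singularValues 0 ≤ σhi)
    {α : ℝ} (hα : 0 ≤ α) (k : ℕ) : 0 < ω.levelSum k α := by
  refine Finset.sum_pos (fun w hw => ?_)
    ⟨List.replicate k 0, by simp [level, ω.replicate_mem_nodes k]⟩
  exact singularValueFun_pos hD hα (ω.wordLin_last_pos hD hlo hσ (by simpa using hw))

theorem levelSum_zero (hD : 1 ≤ D) {α : ℝ} (hα : 0 ≤ α) : ω.levelSum 0 α = 1 := by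
  have h : (ω.level_finite 0).toFinset = {[]} := by
    ext w
    simp [level_zero]
  rw [levelSum, h, Finset.sum_singleton]
  exact singularValueFun_one hD hα

theorem levelSum_succ_eq (α : ℝ) (k : ℕ) :
    ω.levelSum (k + 1) α = ∑ v ∈ (ω.level_finite k).toFinset,
      ∑ w ∈ (ω.level_finite (k + 1)).toFinset with w.dropLast = v,
        singularValueFun α (ω.wordLin w) := by
  refine (Finset.sum_fiberwise_of_maps_to (fun w hw => ?_) _).symm
  have hw' : w ∈ ω.level (k + 1) := by simpa using hw
  obtain ⟨v, l, rfl⟩ := ω.exists_eq_concat_of_mem_level_succ hw'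
  simpa using (ω.concat_mem_level.1 hw').1

theorem levelSum_succ_le (hD : 1 ≤ D) (hlo : 0 < σlo) (hhi : σhi < 1)
    (hσ : ∀ (l : Λ) (i : Fin (F.numMaps l)),
      σlo ≤ (F.lin l i).singularValues (D - 1) ∧ (F.lin l i).singularValues 0 ≤ σhi)
    {M : ℕ} (hM : ∀ l, F.numMaps l ≤ M) {α : ℝ} (hα : 0 ≤ α) (k : ℕ) :
    ω.levelSum (k + 1) α ≤ M * ω.levelSum k α := by
  rw [levelSum_succ_eq, levelSum, Finset.mul_sum]
  refine Finset.sum_le_sum fun v hv => ?_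
  have hv' : v ∈ ω.level k := by simpa using hv
  have hpos := singularValueFun_pos hD hα (ω.wordLin_last_pos hD hlo hσ hv')
  have hcard : ((ω.level_finite (k + 1)).toFinset.filter fun w => w.dropLast = v).card ≤ M := by
    have hsub : ((ω.level_finite (k + 1)).toFinset.filter fun w => w.dropLast = v) ⊆
        (Finset.range M).image fun l => v ++ [l] := by
      intro w hw
      rw [Finset.mem_filter] at hw
      have hw' : w ∈ ω.level (k + 1) := by simpa using hw.1
      obtain ⟨u, l, rfl⟩ := ω.exists_eq_concat_of_mem_level_succ hw'
      obtain ⟨-, a, -, hl⟩ := ω.concat_mem_level.1 hw'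
      have huv : u = v := by simpa using hw.2
      subst huv
      exact Finset.mem_image.2 ⟨l, Finset.mem_range.2 (hl.trans_le (hM a)), rfl⟩
    exact (Finset.card_le_card hsub).trans (Finset.card_image_le.trans (by simp))
  refine (Finset.sum_le_card_nsmul _ _ (singularValueFun α (ω.wordLin v)) fun w hw => ?_).trans ?_
  · rw [Finset.mem_filter] at hw
    have hw' : w ∈ ω.level (k + 1) := by simpa using hw.1
    obtain ⟨u, l, rfl⟩ := ω.exists_eq_concat_of_mem_level_succ hw'
    have huv : u = v := by simpa using hw.2
    subst huv
    have hb := ω.stepLin_bounds hσ (ω.concat_mem_level.1 hw').2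
    have h1 := singularValueFun_le_of_forall_le (S := ω.wordLin (u ++ [l]))
      (T := ω.wordLin u) hD hα one_pos fun i _ => by
        rw [wordLin_concat, mul_one]
        refine (LinearMap.singularValues_comp_le (ω.wordLin u) (ω.stepLin u l) i).trans ?_
        exact mul_le_of_le_one_right (LinearMap.singularValues_nonneg _ _) (hb.2.trans hhi.le)
    simpa using h1
  · rw [nsmul_eq_mul]
    gcongr

theorem le_levelSum_succ (hD : 1 ≤ D) (hlo : 0 < σlo)
    (hσ : ∀ (l : Λ) (i : Fin (F.numMaps l)),
      σlo ≤ (F.lin l i).singularValues (D - 1) ∧ (F.lin l i).singularValues 0 ≤ σhi)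
    {α : ℝ} (hα : 0 ≤ α) (k : ℕ) :
    σlo ^ α * ω.levelSum k α ≤ ω.levelSum (k + 1) α := by
  rw [levelSum_succ_eq, levelSum, Finset.mul_sum]
  refine Finset.sum_le_sum fun v hv => ?_
  have hv' : v ∈ ω.level k := by simpa using hv
  obtain ⟨a, ha⟩ := Option.isSome_iff_exists.1 hv'.1
  have hchild : ∃ a ∈ ω.label v, 0 < F.numMaps a := ⟨a, ha, F.numMaps_pos a⟩
  have hmem : v ++ [0] ∈ ω.level (k + 1) := ω.concat_mem_level.2 ⟨hv', hchild⟩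
  have hb := ω.stepLin_bounds hσ hchild
  have h1 := le_singularValueFun_of_forall_le (S := ω.wordLin (v ++ [0]))
    (T := ω.wordLin v) hD hα hlo fun i _ => by
      rw [wordLin_concat]
      refine le_trans ?_ (singularValues_mul_last_le_mul _ (hlo.trans_le hb.1) i)
      exact mul_le_mul_of_nonneg_left hb.1 (LinearMap.singularValues_nonneg _ _)
  rw [mul_comm]
  refine h1.trans ?_
  refine Finset.single_le_sum (f := fun w => singularValueFun α (ω.wordLin w)) (fun w hw => ?_)
    (Finset.mem_filter.2 ⟨by simpa using hmem, by simp⟩)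
  exact (singularValueFun_pos hD hα
    (ω.wordLin_last_pos hD hlo hσ (by simpa using (Finset.mem_filter.1 hw).1))).le

theorem levelSum_add_le (hD : 1 ≤ D) (hlo : 0 < σlo) (hhi : σhi < 1)
    (hσ : ∀ (l : Λ) (i : Fin (F.numMaps l)),
      σlo ≤ (F.lin l i).singularValues (D - 1) ∧ (F.lin l i).singularValues 0 ≤ σhi)
    {M : ℕ} (hM : ∀ l, F.numMaps l ≤ M) {α : ℝ} (hα : 0 ≤ α) (k j : ℕ) :
    ω.levelSum (k + j) α ≤ M ^ j * ω.levelSum k α := by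
  induction j with
  | zero => simp
  | succ j ih =>
    rw [← add_assoc, pow_succ', mul_assoc]
    exact (ω.levelSum_succ_le hD hlo hhi hσ hM hα _).trans (by gcongr)

theorem le_levelSum_add (hD : 1 ≤ D) (hlo : 0 < σlo)
    (hσ : ∀ (l : Λ) (i : Fin (F.numMaps l)),
      σlo ≤ (F.lin l i).singularValues (D - 1) ∧ (F.lin l i).singularValues 0 ≤ σhi)
    {α : ℝ} (hα : 0 ≤ α) (k j : ℕ) :
    (σlo ^ α) ^ j * ω.levelSum k α ≤ ω.levelSum (k + j) α := by
  induction j with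
  | zero => simp
  | succ j ih =>
    rw [← add_assoc, pow_succ', mul_assoc]
    exact le_trans (by gcongr) (ω.le_levelSum_succ hD hlo hσ hα _)

/-- Going down one level multiplies the level sum by a factor between `σlo ^ α` and `M`. -/
theorem abs_log_levelSum_add_sub_le (hD : 1 ≤ D) (hlo : 0 < σlo) (hhi : σhi < 1)
    (hσ : ∀ (l : Λ) (i : Fin (F.numMaps l)),
      σlo ≤ (F.lin l i).singularValues (D - 1) ∧ (F.lin l i).singularValues 0 ≤ σhi)
    {M : ℕ} (hM1 : 1 ≤ M) (hM : ∀ l, F.numMaps l ≤ M) {α : ℝ} (hα : 0 ≤ α) (k j : ℕ) :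
    |Real.log (ω.levelSum (k + j) α) - Real.log (ω.levelSum k α)| ≤
      (Real.log M + |α * Real.log σlo|) * j := by
  have hk := ω.levelSum_pos hD hlo hσ hα k
  have hkj := ω.levelSum_pos hD hlo hσ hα (k + j)
  have hMpos : (0 : ℝ) < M := by exact_mod_cast hM1
  have hlogM : 0 ≤ Real.log M := Real.log_nonneg (by exact_mod_cast hM1)
  have hc : 0 < σlo ^ α := Real.rpow_pos_of_pos hlo α
  have h1 := Real.log_le_log hkj (ω.levelSum_add_le hD hlo hhi hσ hM hα k j)
  have h2 := Real.log_le_log (by positivity) (ω.le_levelSum_add hD hlo hσ hα k j)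
  rw [Real.log_mul (by positivity) hk.ne', Real.log_pow] at h1
  rw [Real.log_mul (by positivity) hk.ne', Real.log_pow, Real.log_rpow hlo] at h2
  have hj : (0 : ℝ) ≤ j := Nat.cast_nonneg j
  rw [abs_le]
  constructor
  · nlinarith [mul_le_mul_of_nonneg_left (neg_abs_le (α * Real.log σlo)) hj,
      mul_nonneg hj hlogM]
  · nlinarith [mul_nonneg hj (abs_nonneg (α * Real.log σlo))]

theorem levelSum_exponent_le (hD : 1 ≤ D) (hlo : 0 < σlo)
    (hσ : ∀ (l : Λ) (i : Fin (F.numMaps l)),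
      σlo ≤ (F.lin l i).singularValues (D - 1) ∧ (F.lin l i).singularValues 0 ≤ σhi)
    {α β : ℝ} (hα : 0 ≤ α) (hαβ : α ≤ β) (k : ℕ) :
    ω.levelSum k β ≤ ω.levelSum k α * (σhi ^ k) ^ (β - α) := by
  rw [levelSum, levelSum, Finset.sum_mul]
  refine Finset.sum_le_sum fun w hw => ?_
  have hw' : w ∈ ω.level k := by simpa using hw
  exact singularValueFun_exponent_le hD hα hαβ (ω.wordLin_last_pos hD hlo hσ hw')
    (ω.wordLin_bounds hD hlo hσ hw').2

theorem le_levelSum_exponent (hD : 1 ≤ D) (hlo : 0 < σlo)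
    (hσ : ∀ (l : Λ) (i : Fin (F.numMaps l)),
      σlo ≤ (F.lin l i).singularValues (D - 1) ∧ (F.lin l i).singularValues 0 ≤ σhi)
    {α β : ℝ} (hα : 0 ≤ α) (hαβ : α ≤ β) (k : ℕ) :
    ω.levelSum k α * (σlo ^ k) ^ (β - α) ≤ ω.levelSum k β := by
  rw [levelSum, levelSum, Finset.sum_mul]
  refine Finset.sum_le_sum fun w hw => ?_
  exact le_singularValueFun_exponent hD hα hαβ (pow_pos hlo k)
    (ω.wordLin_bounds hD hlo hσ (by simpa using hw)).1

theorem log_levelSum_div_bounds (hD : 1 ≤ D) (hlo : 0 < σlo) (hle : σlo ≤ σhi)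
    (hσ : ∀ (l : Λ) (i : Fin (F.numMaps l)),
      σlo ≤ (F.lin l i).singularValues (D - 1) ∧ (F.lin l i).singularValues 0 ≤ σhi)
    {α β : ℝ} (hα : 0 ≤ α) (hαβ : α ≤ β) {k : ℕ} (hk : 1 ≤ k) :
    Real.log (ω.levelSum k α) / k + (β - α) * Real.log σlo ≤ Real.log (ω.levelSum k β) / k ∧
      Real.log (ω.levelSum k β) / k ≤
        Real.log (ω.levelSum k α) / k + (β - α) * Real.log σhi := by
  have hhi0 := hlo.trans_le hle
  have hk0 : (0 : ℝ) < k := by exact_mod_cast hk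
  have hpα := ω.levelSum_pos hD hlo hσ hα k
  have hpβ := ω.levelSum_pos hD hlo hσ (hα.trans hαβ) k
  have h1 := Real.log_le_log (by positivity) (ω.le_levelSum_exponent hD hlo hσ hα hαβ k)
  have h2 := Real.log_le_log hpβ (ω.levelSum_exponent_le hD hlo hσ hα hαβ k)
  rw [Real.log_mul hpα.ne' (by positivity), Real.log_rpow (by positivity), Real.log_pow] at h1 h2
  constructor
  · rw [div_add' _ _ _ hk0.ne']
    gcongr
    linarith
  · rw [div_add' _ _ _ hk0.ne']
    gcongr
    linarith

end Bounds

/-- If all the sub code trees of `ω` rooted at level `k` equal `ω'`, then the words of length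
`k + j` of `ω` are the concatenations of a word of length `k` of `ω` and one of length `j` of
`ω'`. -/
theorem levelSum_add_eq {ω ω' : CodeTree F} {k : ℕ}
    (h : ∀ u ∈ ω.level k, ∀ w, ω'.label w = ω.label (u ++ w)) (j : ℕ) (α : ℝ) :
    ω.levelSum (k + j) α = ∑ u ∈ (ω.level_finite k).toFinset,
      ∑ v ∈ (ω'.level_finite j).toFinset,
        singularValueFun α (ω.wordLin u * ω'.wordLin v) := by
  have hlin : ∀ u ∈ ω.level k, ∀ t v, ω.linFrom (u ++ t) v = ω'.linFrom t v := by
    intro u hu t v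
    induction v generalizing t with
    | nil => rfl
    | cons i v ih =>
      have hstep : ω.stepLin (u ++ t) i = ω'.stepLin t i := by
        simp only [stepLin, h u hu t]
      rw [linFrom, linFrom, hstep, List.append_assoc, ih]
  rw [← Finset.sum_product', levelSum]
  symm
  refine Finset.sum_bij' (fun q _ => q.1 ++ q.2) (fun w _ => (w.take k, w.drop k)) ?_ ?_ ?_ ?_ ?_
  · rintro ⟨u, v⟩ hq
    simp only [Finset.mem_product, Set.Finite.mem_toFinset] at hq ⊢
    refine ⟨?_, by simp [hq.1.2, hq.2.2]⟩
    have := hq.2.1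
    simp only [nodes, Set.mem_ofPred_eq] at this ⊢
    rwa [← h u hq.1]
  · intro w hw
    simp only [Finset.mem_product, Set.Finite.mem_toFinset] at hw ⊢
    have hw1 : w.take k ∈ ω.level k :=
      ⟨ω.mem_nodes_of_append (v := w.drop k) (by rw [List.take_append_drop]; exact hw.1), by
        have := hw.2
        simp only [List.length_take]
        omega⟩
    refine ⟨hw1, ?_, by simp [hw.2]⟩
    simp only [nodes, Set.mem_ofPred_eq]
    rw [h _ hw1, List.take_append_drop]
    exact hw.1
  · rintro ⟨u, v⟩ hq
    simp only [Finset.mem_product, Set.Finite.mem_toFinset] at hq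
    have := hq.1.2
    simp [← this]
  · intro w _
    simp
  · rintro ⟨u, v⟩ hq
    simp only [Finset.mem_product, Set.Finite.mem_toFinset] at hq
    have := hlin u hq.1 [] v
    rw [List.append_nil] at this
    simp [wordLin, linFrom_append, this]

/-- The sum over level `k` is determined by the labels of the words shorter than `k`. -/
theorem levelSum_congr {ω ω' : CodeTree F} {k : ℕ}
    (h : ∀ w : List ℕ, w.length < k → ω.label w = ω'.label w) (α : ℝ) :
    ω.levelSum k α = ω'.levelSum k α := by
  have hnode : ∀ w : List ℕ, w.length ≤ k → (w ∈ ω.nodes ↔ w ∈ ω'.nodes) := by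
    intro w hw
    rcases List.eq_nil_or_concat w with rfl | ⟨v, l, rfl⟩
    · exact iff_of_true ω.root ω'.root
    · rw [List.concat_eq_append] at hw ⊢
      have hv : v.length < k := by
        rw [List.length_append, List.length_singleton] at hw
        omega
      simp only [nodes, Set.mem_ofPred_eq]
      rw [ω.child, ω'.child, h v hv]
  have hlin : ∀ t v : List ℕ, t.length + v.length ≤ k → ω.linFrom t v = ω'.linFrom t v := by
    intro t v
    induction v generalizing t with
    | nil => intro _; rfl
    | cons i v ih =>
      intro htv
      rw [List.length_cons] at htv
      have hstep : ω.stepLin t i = ω'.stepLin t i := by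
        simp only [stepLin, h t (by omega)]
      rw [linFrom, linFrom, hstep, ih (t ++ [i]) (by simp; omega)]
  have hlev : (ω.level_finite k).toFinset = (ω'.level_finite k).toFinset := by
    ext w
    simp only [Set.Finite.mem_toFinset, level, Set.mem_ofPred_eq]
    exact and_congr_left fun hw => hnode w hw.le
  rw [levelSum, levelSum, hlev]
  refine Finset.sum_congr rfl fun w hw => ?_
  have hw' : w ∈ ω'.level k := by simpa using hw
  rw [wordLin, wordLin, hlin [] w (by simp [hw'.2])]

end CodeTree

/-! ### Iterates of the shift -/

namespace NeckedCodeTree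

variable {Λ : Type*} {D : ℕ} {F : AffineIFSFamily Λ D}

theorem iterate_shift_neck (x : NeckedCodeTree F) (m n : ℕ) :
    (shift^[m] x).neck n = x.neck (m + n) - x.neck m := by
  induction m generalizing n with
  | zero => simp [x.neck_zero]
  | succ m ih =>
    rw [Function.iterate_succ_apply']
    change (shift^[m] x).neck (n + 1) - (shift^[m] x).neck 1 = _
    rw [ih, ih, show m + (n + 1) = m + 1 + n by ring]
    have h1 : x.neck m ≤ x.neck (m + 1) := x.neck_strictMono.monotone (by omega)
    have h2 : x.neck (m + 1) ≤ x.neck (m + 1 + n) := x.neck_strictMono.monotone (by omega)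
    omega

theorem iterate_shift_label (x : NeckedCodeTree F) (m : ℕ) {u : List ℕ}
    (hu : u ∈ x.level (x.neck m)) (w : List ℕ) :
    (shift^[m] x).label w = x.label (u ++ w) := by
  suffices h : ∀ w, (shift^[m] x).label w = x.label (List.replicate (x.neck m) 0 ++ w) by
    rw [h w]
    exact x.identical m _ ⟨x.replicate_mem_nodes _, by simp⟩ u hu w
  clear hu w
  induction m with
  | zero => simp [x.neck_zero]
  | succ m ih =>
    intro w
    rw [Function.iterate_succ_apply']
    change (shift^[m] x).label (List.replicate ((shift^[m] x).neck 1) 0 ++ w) = _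
    rw [ih, iterate_shift_neck, ← List.append_assoc, List.replicate_append_replicate]
    have h1 : x.neck m ≤ x.neck (m + 1) := x.neck_strictMono.monotone (by omega)
    congr 3
    omega

theorem birkhoffSum_neck_one (x : NeckedCodeTree F) (n : ℕ) :
    birkhoffSum shift (fun y : NeckedCodeTree F => (y.neck 1 : ℝ)) n x = x.neck n := by
  induction n with
  | zero => simp [x.neck_zero]
  | succ n ih =>
    rw [birkhoffSum_succ, ih, iterate_shift_neck,
      Nat.cast_sub (x.neck_strictMono.monotone (by omega))]
    ring

/-- A function that is constant on the cylinders of depth `m` is locally constant. -/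
theorem measurable_of_forall_mem_cylinder {g : NeckedCodeTree F → ℝ} {m : ℕ} (hm : 1 ≤ m)
    (hg : ∀ x, ∀ y ∈ x.cylinder m, g y = g x) : Measurable g := by
  intro s _
  have h : g ⁻¹' s = ⋃ x ∈ g ⁻¹' s, x.cylinder m := by
    ext y
    simp only [Set.mem_iUnion, Set.mem_preimage, exists_prop]
    constructor
    · intro hy
      exact ⟨y, hy, fun _ _ => rfl, fun _ _ => rfl⟩
    · rintro ⟨x, hx, hy⟩
      rwa [hg x y hy]
  rw [h]
  refine IsOpen.measurableSet (isOpen_biUnion fun x _ => ?_)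
  exact TopologicalSpace.isOpen_generateFrom_of_mem ⟨x, m, hm, rfl⟩

theorem measurable_neck_one : Measurable fun x : NeckedCodeTree F => (x.neck 1 : ℝ) :=
  measurable_of_forall_mem_cylinder le_rfl fun x y hy => by rw [hy.1 1 le_rfl]

theorem measurable_log_levelSum_neck (n : ℕ) (α : ℝ) :
    Measurable fun x : NeckedCodeTree F => Real.log (x.levelSum (x.neck n) α) := by
  refine measurable_of_forall_mem_cylinder (Nat.le_add_left 1 n) fun x y hy => ?_
  have hneck : x.neck n ≤ x.neck (n + 1) := x.neck_strictMono.monotone (by omega)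
  rw [hy.1 n (by omega),
    CodeTree.levelSum_congr (ω := y.toCodeTree) (ω' := x.toCodeTree) fun w hw =>
      hy.2 w (hw.trans_le hneck)]

theorem levelSum_neck_add_eq (x : NeckedCodeTree F) (m n : ℕ) (α : ℝ) :
    x.levelSum (x.neck (m + n)) α = ∑ u ∈ (x.level_finite (x.neck m)).toFinset,
      ∑ v ∈ ((shift^[m] x).level_finite ((shift^[m] x).neck n)).toFinset,
        singularValueFun α (x.wordLin u * (shift^[m] x).wordLin v) := by
  rw [← CodeTree.levelSum_add_eq fun u hu w => x.iterate_shift_label m hu w,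
    iterate_shift_neck, Nat.add_sub_cancel' (x.neck_strictMono.monotone (by omega))]

section Bounds

variable {σlo σhi : ℝ}

theorem log_levelSum_neck_add_le (hD : 1 ≤ D) (hlo : 0 < σlo)
    (hσ : ∀ (l : Λ) (i : Fin (F.numMaps l)),
      σlo ≤ (F.lin l i).singularValues (D - 1) ∧ (F.lin l i).singularValues 0 ≤ σhi)
    {α : ℝ} (hα : 0 ≤ α) (hαD : α < D) (m n : ℕ) (x : NeckedCodeTree F) :
    Real.log (x.levelSum (x.neck (m + n)) α) ≤ Real.log (x.levelSum (x.neck m) α) +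
      Real.log ((shift^[m] x).levelSum ((shift^[m] x).neck n) α) := by
  rw [← Real.log_mul (x.levelSum_pos hD hlo hσ hα _).ne'
    ((shift^[m] x).levelSum_pos hD hlo hσ hα _).ne']
  refine Real.log_le_log (x.levelSum_pos hD hlo hσ hα _) ?_
  rw [levelSum_neck_add_eq, CodeTree.levelSum, CodeTree.levelSum, Finset.sum_mul_sum]
  exact Finset.sum_le_sum fun u _ => Finset.sum_le_sum fun v _ => singularValueFun_mul_le hα hαD _ _

theorem le_log_levelSum_neck_add (hD : 1 ≤ D) (hlo : 0 < σlo)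
    (hσ : ∀ (l : Λ) (i : Fin (F.numMaps l)),
      σlo ≤ (F.lin l i).singularValues (D - 1) ∧ (F.lin l i).singularValues 0 ≤ σhi)
    {α : ℝ} (hαD : D ≤ α) (m n : ℕ) (x : NeckedCodeTree F) :
    Real.log (x.levelSum (x.neck m) α) +
      Real.log ((shift^[m] x).levelSum ((shift^[m] x).neck n) α) ≤
      Real.log (x.levelSum (x.neck (m + n)) α) := by
  have hα : 0 ≤ α := (Nat.cast_nonneg D).trans hαD
  have h1 := x.levelSum_pos hD hlo hσ hα (x.neck m)
  have h2 := (shift^[m] x).levelSum_pos hD hlo hσ hα ((shift^[m] x).neck n)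
  rw [← Real.log_mul h1.ne' h2.ne']
  refine Real.log_le_log (mul_pos h1 h2) ?_
  rw [levelSum_neck_add_eq, CodeTree.levelSum, CodeTree.levelSum, Finset.sum_mul_sum]
  refine Finset.sum_le_sum fun u hu => Finset.sum_le_sum fun v hv => ?_
  exact le_singularValueFun_mul hD hαD (x.wordLin_last_pos hD hlo hσ (by simpa using hu))
    ((shift^[m] x).wordLin_last_pos hD hlo hσ (by simpa using hv))

end Bounds

end NeckedCodeTree

/-! ### From the neck levels to all levels -/

open MeasureTheory Filter Topology

/-- If `s` has increments at most `C` and grows linearly along a sequence `N` of positive density,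
then it grows linearly. -/
theorem tendsto_div_of_tendsto_subsequence {N : ℕ → ℕ} (hN0 : N 0 = 0) (hN : StrictMono N)
    {s : ℕ → ℝ} {C ν γ : ℝ} (hν : 0 < ν)
    (hs : ∀ k j, |s (k + j) - s k| ≤ C * j)
    (h1 : Tendsto (fun n : ℕ => (N n : ℝ) / n) atTop (𝓝 ν))
    (h2 : Tendsto (fun n : ℕ => s (N n) / n) atTop (𝓝 γ)) :
    Tendsto (fun k : ℕ => s k / k) atTop (𝓝 (γ / ν)) := by
  -- `i k` is the index of the last neck at or below level `k`.
  let i : ℕ → ℕ := fun k => Nat.findGreatest (fun n => N n ≤ k) k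
  have hi1 : ∀ k, N (i k) ≤ k := fun k =>
    Nat.findGreatest_spec (P := fun n => N n ≤ k) (Nat.zero_le k) (by simp [hN0])
  have hi2 : ∀ k, k < N (i k + 1) := by
    intro k
    by_contra h
    push Not at h
    have h3 : i k + 1 ≤ i k :=
      Nat.le_findGreatest (P := fun n => N n ≤ k) ((hN.le_apply).trans h) h
    omega
  have hi : Tendsto i atTop atTop := by
    refine tendsto_atTop.2 fun b => ?_
    filter_upwards [eventually_ge_atTop (N b)] with k hk
    exact Nat.le_findGreatest (P := fun n => N n ≤ k) ((hN.le_apply).trans hk) hk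
  have hpos : ∀ᶠ k in atTop, (0 : ℝ) < i k := by
    filter_upwards [hi.eventually_ge_atTop 1] with k hk
    exact_mod_cast hk
  have h1i := h1.comp hi
  have h1s : Tendsto (fun n : ℕ => (N (n + 1) : ℝ) / n) atTop (𝓝 ν) := by
    have h3 := (tendsto_add_atTop_iff_nat (f := fun n : ℕ => (N n : ℝ) / n) 1).2 h1
    have h4 : Tendsto (fun n : ℕ => 1 + 1 / (n : ℝ)) atTop (𝓝 (1 + 0)) :=
      tendsto_const_nhds.add tendsto_one_div_atTop_nhds_zero_nat
    have h5 := h3.mul h4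
    rw [add_zero, mul_one] at h5
    refine h5.congr' ?_
    filter_upwards [eventually_ge_atTop 1] with n hn
    have hn0 : (n : ℝ) ≠ 0 := by
      have : n ≠ 0 := by omega
      exact_mod_cast this
    have hn1 : (n : ℝ) + 1 ≠ 0 := by positivity
    push_cast
    field_simp
  have hk : Tendsto (fun k : ℕ => (k : ℝ) / i k) atTop (𝓝 ν) := by
    refine tendsto_of_tendsto_of_tendsto_of_le_of_le h1i (h1s.comp hi) (fun k => ?_) fun k => ?_
    · have : (N (i k) : ℝ) ≤ k := by exact_mod_cast hi1 k
      simp only [Function.comp_apply]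
      gcongr
    · have : (k : ℝ) ≤ N (i k + 1) := by exact_mod_cast (hi2 k).le
      simp only [Function.comp_apply]
      gcongr
  have herr : Tendsto (fun k : ℕ => (s k - s (N (i k))) / i k) atTop (𝓝 0) := by
    have h3 : Tendsto (fun k : ℕ => C * ((k : ℝ) / i k - (N (i k) : ℝ) / i k)) atTop
        (𝓝 (C * (ν - ν))) := (hk.sub h1i).const_mul C
    rw [sub_self, mul_zero] at h3
    refine squeeze_zero_norm (fun k => ?_) h3
    have h4 := hs (N (i k)) (k - N (i k))
    rw [Nat.add_sub_cancel' (hi1 k), Nat.cast_sub (hi1 k)] at h4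
    rw [Real.norm_eq_abs, abs_div, Nat.abs_cast, ← sub_div, ← mul_div_assoc]
    gcongr
  have hsk : Tendsto (fun k : ℕ => s k / i k) atTop (𝓝 γ) := by
    have h3 := herr.add (h2.comp hi)
    rw [zero_add] at h3
    refine h3.congr fun k => ?_
    simp only [Function.comp_apply]
    ring
  refine (hsk.div hk hν.ne').congr' ?_
  filter_upwards [hpos] with k hk0
  rw [Pi.div_apply, div_div_div_cancel_right₀ hk0.ne']

section Pressure

variable {Λ : Type*} {D : ℕ} {F : AffineIFSFamily Λ D} {σlo σhi : ℝ}

/-- The pressure at a fixed `α` exists and is almost surely constant. The logarithms of the sums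
over the neck levels are subadditive for `α < D` and superadditive for `α ≥ D`. -/
theorem exists_ae_hasPressure (hD : 1 ≤ D) (hlo : 0 < σlo) (hhi : σhi < 1)
    (hσ : ∀ (l : Λ) (i : Fin (F.numMaps l)),
      σlo ≤ (F.lin l i).singularValues (D - 1) ∧ (F.lin l i).singularValues 0 ≤ σhi)
    {P : Measure (NeckedCodeTree F)} [IsProbabilityMeasure P]
    (hP : Ergodic NeckedCodeTree.shift P)
    (hN : Integrable (fun x : NeckedCodeTree F => (x.neck 1 : ℝ)) P) {α : ℝ} (hα : 0 ≤ α) :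
    ∃ p : ℝ, ∀ᵐ x ∂P, x.HasPressure α p := by
  obtain ⟨M₀, hM₀⟩ := F.numMaps_bdd
  have hM : ∀ l, F.numMaps l ≤ M₀ + 1 := fun l => (hM₀ ⟨l, rfl⟩).trans (Nat.le_succ _)
  set C : ℝ := Real.log (M₀ + 1 : ℕ) + |α * Real.log σlo| with hC
  have hinc : ∀ (x : NeckedCodeTree F) (k j : ℕ),
      |Real.log (x.levelSum (k + j) α) - Real.log (x.levelSum k α)| ≤ C * j := fun x k j =>
    x.abs_log_levelSum_add_sub_le hD hlo hhi hσ (Nat.le_add_left 1 M₀) hM hα k j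
  let g : ℕ → NeckedCodeTree F → ℝ := fun n x => Real.log (x.levelSum (x.neck n) α)
  have hgm : ∀ n, Measurable (g n) := fun n => NeckedCodeTree.measurable_log_levelSum_neck n α
  have hbd : ∀ n x, |g n x| ≤
      birkhoffSum NeckedCodeTree.shift (fun y : NeckedCodeTree F => C * (y.neck 1 : ℝ)) n x := by
    intro n x
    have h1 := hinc x 0 (x.neck n)
    rw [zero_add, x.levelSum_zero hD hα, Real.log_one, sub_zero] at h1
    have h2 : birkhoffSum NeckedCodeTree.shift
        (fun y : NeckedCodeTree F => C * (y.neck 1 : ℝ)) n x = C * x.neck n := by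
      rw [← x.birkhoffSum_neck_one n, birkhoffSum, birkhoffSum, Finset.mul_sum]
    rw [h2]
    exact h1
  have hφm : Measurable fun y : NeckedCodeTree F => C * (y.neck 1 : ℝ) :=
    NeckedCodeTree.measurable_neck_one.const_mul C
  obtain ⟨γ, hγ⟩ : ∃ γ : ℝ, ∀ᵐ x ∂P, Tendsto (fun n : ℕ => g n x / n) atTop (𝓝 γ) := by
    rcases lt_or_ge α D with hαD | hαD
    · exact hP.exists_ae_tendsto_div_of_subadditive hgm
        (fun m n x => x.log_levelSum_neck_add_le hD hlo hσ hα hαD m n) hφm (hN.const_mul C) hbd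
    · obtain ⟨γ, hγ⟩ := hP.exists_ae_tendsto_div_of_subadditive (g := fun n x => -g n x)
        (fun n => (hgm n).neg)
        (fun m n x => by
          have := x.le_log_levelSum_neck_add hD hlo hσ hαD m n
          simp only [g]
          linarith)
        hφm (hN.const_mul C) (fun n x => by rw [abs_neg]; exact hbd n x)
      refine ⟨-γ, ?_⟩
      filter_upwards [hγ] with x hx
      refine hx.neg.congr fun n => ?_
      ring
  have hν : 0 < ∫ x : NeckedCodeTree F, (x.neck 1 : ℝ) ∂P := by
    have h1 : ∫ _ : NeckedCodeTree F, (1 : ℝ) ∂P ≤ ∫ x : NeckedCodeTree F, (x.neck 1 : ℝ) ∂P := by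
      refine integral_mono (integrable_const 1) hN fun x => ?_
      have h2 : x.neck 0 < x.neck 1 := x.neck_strictMono Nat.zero_lt_one
      have h3 : 1 ≤ x.neck 1 := by omega
      dsimp only
      exact_mod_cast h3
    rw [integral_const] at h1
    simp only [probReal_univ, smul_eq_mul, mul_one] at h1
    linarith
  refine ⟨γ / ∫ x : NeckedCodeTree F, (x.neck 1 : ℝ) ∂P, ?_⟩
  filter_upwards [hγ, hP.ae_tendsto_birkhoffSum_div NeckedCodeTree.measurable_neck_one hN]
    with x hx1 hx2
  simp_rw [x.birkhoffSum_neck_one] at hx2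
  exact tendsto_div_of_tendsto_subsequence x.neck_zero x.neck_strictMono hν (hinc x) hx2 hx1

theorem CodeTree.HasPressure.bounds (hD : 1 ≤ D) (hlo : 0 < σlo) (hle : σlo ≤ σhi)
    (hσ : ∀ (l : Λ) (i : Fin (F.numMaps l)),
      σlo ≤ (F.lin l i).singularValues (D - 1) ∧ (F.lin l i).singularValues 0 ≤ σhi)
    {ω : CodeTree F} {α β p q : ℝ} (hα : 0 ≤ α) (hαβ : α ≤ β)
    (hp : ω.HasPressure α p) (hq : ω.HasPressure β q) :
    p + (β - α) * Real.log σlo ≤ q ∧ q ≤ p + (β - α) * Real.log σhi := by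
  have h := fun k (hk : 1 ≤ k) => ω.log_levelSum_div_bounds hD hlo hle hσ hα hαβ hk
  constructor
  · refine le_of_tendsto_of_tendsto (hp.add_const _) hq ?_
    filter_upwards [eventually_ge_atTop 1] with k hk using (h k hk).1
  · refine le_of_tendsto_of_tendsto hq (hp.add_const _) ?_
    filter_upwards [eventually_ge_atTop 1] with k hk using (h k hk).2

theorem CodeTree.HasPressure.zero_nonneg (hD : 1 ≤ D) (hlo : 0 < σlo)
    (hσ : ∀ (l : Λ) (i : Fin (F.numMaps l)),
      σlo ≤ (F.lin l i).singularValues (D - 1) ∧ (F.lin l i).singularValues 0 ≤ σhi)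
    {ω : CodeTree F} {p : ℝ} (hp : ω.HasPressure 0 p) : 0 ≤ p := by
  refine ge_of_tendsto' hp fun k => ?_
  have h := ω.le_levelSum_add hD hlo hσ le_rfl 0 k
  rw [Real.rpow_zero, one_pow, one_mul, zero_add, ω.levelSum_zero hD le_rfl] at h
  exact div_nonneg (Real.log_nonneg h) (Nat.cast_nonneg k)

/-- Since `α ↦ log S(k, α) / k` is Lipschitz uniformly in `k`, it suffices to know the pressure at
the rational `α`. -/
theorem CodeTree.hasPressure_of_forall_rat (hD : 1 ≤ D) (hlo : 0 < σlo) (hle : σlo ≤ σhi)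
    (hhi : σhi < 1)
    (hσ : ∀ (l : Λ) (i : Fin (F.numMaps l)),
      σlo ≤ (F.lin l i).singularValues (D - 1) ∧ (F.lin l i).singularValues 0 ≤ σhi)
    {ω : CodeTree F} {p : ℝ → ℝ}
    (hp : ∀ α β, 0 ≤ α → α ≤ β → p α + (β - α) * Real.log σlo ≤ p β ∧ p β ≤ p α)
    (hrat : ∀ q : ℚ, 0 ≤ (q : ℝ) → ω.HasPressure q (p q)) {α : ℝ} (hα : 0 ≤ α) :
    ω.HasPressure α (p α) := by
  have hlog : Real.log σlo < 0 := Real.log_neg hlo (hle.trans_lt hhi)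
  have hloghi : Real.log σhi < 0 := Real.log_neg (hlo.trans_le hle) hhi
  rw [HasPressure, Metric.tendsto_atTop']
  intro ε hε
  obtain ⟨q, hq1, hq2⟩ := exists_rat_btwn
    (lt_add_of_pos_right α (div_pos hε (mul_pos (by norm_num : (0 : ℝ) < 3) (neg_pos.2 hlog))))
  have hq3 : (q - α) * -Real.log σlo < ε / 3 := by
    have h1 : (q : ℝ) - α < ε / (3 * -Real.log σlo) := by linarith
    rw [lt_div_iff₀ (by linarith)] at h1
    linarith
  obtain ⟨N, hN⟩ := Metric.tendsto_atTop'.1 (hrat q (hα.trans hq1.le)) (ε / 3) (by linarith)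
  refine ⟨N, fun k hk => ?_⟩
  have h1 := hN k hk
  obtain ⟨h2, h3⟩ := ω.log_levelSum_div_bounds hD hlo hle hσ hα hq1.le (k := k) (by omega)
  obtain ⟨h4, h5⟩ := hp α q hα hq1.le
  have h6 : ((q : ℝ) - α) * Real.log σhi ≤ 0 :=
    mul_nonpos_of_nonneg_of_nonpos (by linarith) hloghi.le
  rw [Real.dist_eq, abs_lt] at h1 ⊢
  constructor <;> linarith [h1.1, h1.2]

end Pressure

theorem theorem4p3 {Λ : Type*} {D : ℕ} (hD : 1 ≤ D) (F : AffineIFSFamily Λ D)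
    (σlo σhi : ℝ) (hlo : 0 < σlo) (hle : σlo ≤ σhi) (hhi : σhi < 1)
    (hσ : ∀ (l : Λ) (i : Fin (F.numMaps l)),
      σlo ≤ (F.lin l i).singularValues (D - 1) ∧ (F.lin l i).singularValues 0 ≤ σhi)
    (P : MeasureTheory.Measure (NeckedCodeTree F)) [MeasureTheory.IsProbabilityMeasure P]
    (hP : Ergodic NeckedCodeTree.shift P)
    (hN : MeasureTheory.Integrable (fun x : NeckedCodeTree F => (x.neck 1 : ℝ)) P) :
    ∃ p : ℝ → ℝ,
      (∀ᵐ x ∂P, ∀ α : ℝ, 0 ≤ α → x.HasPressure α (p α)) ∧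
      StrictAntiOn p (Set.Ici 0) ∧
      ContinuousOn p (Set.Ici 0) ∧
      ∃! α₀ : ℝ, 0 ≤ α₀ ∧ p α₀ = 0 := by
  have hloglo : Real.log σlo < 0 := Real.log_neg hlo (hle.trans_lt hhi)
  have hloghi : Real.log σhi < 0 := Real.log_neg (hlo.trans_le hle) hhi
  have hex : ∀ α : ℝ, ∃ p : ℝ, 0 ≤ α → ∀ᵐ x ∂P, x.HasPressure α p := by
    intro α
    by_cases hα : 0 ≤ α
    · obtain ⟨p, hp⟩ := exists_ae_hasPressure hD hlo hhi hσ hP hN hα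
      exact ⟨p, fun _ => hp⟩
    · exact ⟨0, fun h => absurd h hα⟩
  choose p hp using hex
  have hbd : ∀ α β, 0 ≤ α → α ≤ β →
      p α + (β - α) * Real.log σlo ≤ p β ∧ p β ≤ p α + (β - α) * Real.log σhi := by
    intro α β hα hαβ
    obtain ⟨x, hx1, hx2⟩ := ((hp α hα).and (hp β (hα.trans hαβ))).exists
    exact hx1.bounds hD hlo hle hσ hα hαβ hx2
  have hanti : StrictAntiOn p (Set.Ici 0) := by
    intro α hα β _ hαβ
    have h1 := (hbd α β hα hαβ.le).2
    have h2 := mul_neg_of_pos_of_neg (sub_pos.2 hαβ) hloghi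
    linarith
  have hcont : ContinuousOn p (Set.Ici 0) := by
    refine LipschitzOnWith.continuousOn (K := Real.toNNReal (-Real.log σlo))
      (LipschitzOnWith.of_le_add_mul _ fun α hα β hβ => ?_)
    rw [Real.coe_toNNReal _ (by linarith), Real.dist_eq]
    rcases le_total α β with h | h
    · have h1 := (hbd α β hα h).1
      rw [abs_of_nonpos (by linarith)]
      linarith
    · have h1 := (hbd β α hβ h).2
      have h2 := mul_nonpos_of_nonneg_of_nonpos (sub_nonneg.2 h) hloghi.le
      have h3 := mul_nonneg (neg_nonneg.2 hloglo.le) (abs_nonneg (α - β))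
      linarith
  refine ⟨p, ?_, hanti, hcont, ?_⟩
  · have hrat : ∀ᵐ x ∂P, ∀ q : ℚ, 0 ≤ (q : ℝ) → x.HasPressure q (p q) := by
      refine ae_all_iff.2 fun q => ?_
      by_cases hq : 0 ≤ (q : ℝ)
      · filter_upwards [hp q hq] with x hx _ using hx
      · exact ae_of_all _ fun x h => absurd h hq
    filter_upwards [hrat] with x hx α hα
    exact CodeTree.hasPressure_of_forall_rat hD hlo hle hhi hσ (fun a b ha hab =>
      ⟨(hbd a b ha hab).1, hanti.antitoneOn ha (ha.trans hab) hab⟩) hx hα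
  · have hp0 : 0 ≤ p 0 := by
      obtain ⟨x, hx⟩ := (hp 0 le_rfl).exists
      exact hx.zero_nonneg hD hlo hσ
    set b : ℝ := p 0 / -Real.log σhi with hb
    have hb0 : 0 ≤ b := div_nonneg hp0 (by linarith)
    have hpb : p b ≤ 0 := by
      have h1 := (hbd 0 b le_rfl hb0).2
      have h2 : b * -Real.log σhi = p 0 := div_mul_cancel₀ _ (by linarith)
      linarith
    obtain ⟨α₀, hα₀, hroot⟩ := intermediate_value_Icc' hb0
      (hcont.mono Set.Icc_subset_Ici_self) ⟨hpb, hp0⟩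
    exact ⟨α₀, ⟨hα₀.1, hroot⟩, fun β hβ => hanti.injOn hβ.1 hα₀.1 (hβ.2.trans hroot.symm)⟩
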